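/- Let $L^2$ be a smooth surface (2-manifold) and let $g\colon L^2\to\mathbb{S}^3\subset\mathbb{R}^4$ be a smooth immersion whose induced metric $\langle\,,\,\rangle$ has Gauss curvature $K\neq 1$ everywhere. Then $g$ is locally a surface of type $D$ away from its umbilic points. That is, every point $p\in L^2$ that is not an umbilic point of $g$ has an open neighborhood $U\subset L^2$ on which there are linearly independent smooth vector fields $X,Y$ with $\|Y\|=1$ such that, everywhere on $U$, $$ \langle X,Y\rangle\neq 0,\qquad \nabla_XY=0,\qquad \alpha_g(X,Y)=0 . $$ Here $\nabla$ is the Levi-Civita connection of the induced metric, $\alpha_g$ is the second fundamental form of $g$ in $\mathbb{S}^3$, and $p$ is umbilic if $\alpha_g(v,w)=\langle v,w\rangle\,\zeta$ for some fixed vector $\zeta$ and all $v,w\in T_pL$. -/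

import Mathlib

open scoped Manifold ContDiff

noncomputable section

namespace SphereSurface

/-- The coordinate plane. -/
abbrev Plane : Type := EuclideanSpace ℝ (Fin 2)

/-- The unit sphere `𝕊ⁿ` of `ℝⁿ⁺¹`, with the smooth structure given by Mathlib. -/
abbrev UnitSphere (n : ℕ) : Type := Metric.sphere (0 : EuclideanSpace ℝ (Fin (n + 1))) 1

/-- The partial derivative `∂ᵢ f` of a map on the coordinate plane. -/
def pd {E : Type*} [NormedAddCommGroup E] [NormedSpace ℝ E] (i : Fin 2) (f : Plane → E)
    (u : Plane) : E :=
  fderiv ℝ f u (EuclideanSpace.single i 1)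

/-! ### Riemannian geometry of a metric `G = (Gᵢⱼ)` on an open set of the coordinate plane -/

/-- The Christoffel symbols `Γᵏᵢⱼ = ½ ∑ₗ Gᵏˡ (∂ᵢ Gⱼₗ + ∂ⱼ Gᵢₗ - ∂ₗ Gᵢⱼ)` of the Levi-Civita
connection, so that `∇_{∂ᵢ} ∂ⱼ = ∑ₖ Γᵏᵢⱼ ∂ₖ`. -/
def christoffel (G : Plane → Matrix (Fin 2) (Fin 2) ℝ) (k i j : Fin 2) (u : Plane) : ℝ :=
  (1 / 2) * ∑ l, (G u)⁻¹ k l *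
    (pd i (fun w => G w j l) u + pd j (fun w => G w i l) u - pd l (fun w => G w i j) u)

/-- The components of the curvature tensor
`R(X, Y) Z = ∇_X ∇_Y Z - ∇_Y ∇_X Z - ∇_{[X, Y]} Z`:
`R(∂ᵢ, ∂ⱼ) ∂ₖ = ∑ₗ (riemann G l i j k) ∂ₗ`. -/
def riemann (G : Plane → Matrix (Fin 2) (Fin 2) ℝ) (l i j k : Fin 2) (u : Plane) : ℝ :=
  pd i (christoffel G l j k) u - pd j (christoffel G l i k) u
    + ∑ m, (christoffel G m j k u * christoffel G l i m u
      - christoffel G m i k u * christoffel G l j m u)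

/-- The Gauss (sectional) curvature
`⟨R(∂₀, ∂₁) ∂₁, ∂₀⟩ / (⟨∂₀, ∂₀⟩ ⟨∂₁, ∂₁⟩ - ⟨∂₀, ∂₁⟩²)` of the metric `G`. -/
def metricGaussCurvature (G : Plane → Matrix (Fin 2) (Fin 2) ℝ) (u : Plane) : ℝ :=
  (∑ l, riemann G l 0 1 1 u * G u l 0) / (G u).det

/-! ### Surfaces in the unit sphere -/

section Surface

variable {L : Type*} [TopologicalSpace L] [ChartedSpace (EuclideanSpace ℝ (Fin 2)) L] {n : ℕ}

/-- `g : L² → 𝕊ⁿ` is a surface: a smooth immersion. -/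
structure IsSurface (g : L → UnitSphere n) : Prop where
  contMDiff : ContMDiff (𝓡 2) (𝓡 n) ∞ g
  injective_mfderiv : ∀ x, Function.Injective (mfderiv (𝓡 2) (𝓡 n) g x)

/-- The position vector of `g` in `ℝⁿ⁺¹`. -/
def position (g : L → UnitSphere n) (x : L) : EuclideanSpace ℝ (Fin (n + 1)) := g x

/-- The differential `g_* v ∈ ℝⁿ⁺¹` of a tangent vector `v` of `L` at `x`. -/
def pushforward (g : L → UnitSphere n) (x : L) (v : TangentSpace (𝓡 2) x) :
    EuclideanSpace ℝ (Fin (n + 1)) :=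
  mfderiv (𝓡 2) 𝓘(ℝ, EuclideanSpace ℝ (Fin (n + 1))) (position g) x v

/-- The metric induced by `g`. -/
def inducedMetric (g : L → UnitSphere n) (x : L) (v w : TangentSpace (𝓡 2) x) : ℝ :=
  inner ℝ (pushforward g x v) (pushforward g x w)

/-- The position vector in the preferred chart at `p`. -/
def localPosition (g : L → UnitSphere n) (p : L) (u : Plane) :
    EuclideanSpace ℝ (Fin (n + 1)) :=
  position g ((extChartAt (𝓡 2) p).symm u)

/-- The matrix `⟨∂ᵢ g, ∂ⱼ g⟩` of the induced metric in the preferred chart at `p`. -/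
def localMetric (g : L → UnitSphere n) (p : L) (u : Plane) : Matrix (Fin 2) (Fin 2) ℝ :=
  Matrix.of fun i j => inner ℝ (pd i (localPosition g p) u) (pd j (localPosition g p) u)

/-- The Gauss curvature `K` of the metric induced by `g`, at the point `x` of `L`. -/
def gaussCurvature (g : L → UnitSphere n) (x : L) : ℝ :=
  metricGaussCurvature (localMetric g x) (extChartAt (𝓡 2) x x)

/-- The components of a tangent vector at `x` in the coordinate basis of the preferred chart at
`x`; in Mathlib a tangent vector at `x` is by definition this pair of numbers. -/
def comp {x : L} (v : TangentSpace (𝓡 2) x) (i : Fin 2) : ℝ :=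
  (show EuclideanSpace ℝ (Fin 2) from v) i

/-- The component functions of the vector field `Y` in the preferred chart at `p`. -/
def localField (p : L) (Y : ∀ x : L, TangentSpace (𝓡 2) x) (k : Fin 2) (u : Plane) : ℝ :=
  (show EuclideanSpace ℝ (Fin 2) from
    mfderiv (𝓡 2) 𝓘(ℝ, EuclideanSpace ℝ (Fin 2)) (extChartAt (𝓡 2) p)
      ((extChartAt (𝓡 2) p).symm u) (Y ((extChartAt (𝓡 2) p).symm u))) k

/-- The covariant derivative `∇ᵍ_v Y` at `x`, for `v` tangent to `L` at `x`, with respect to the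
Levi-Civita connection of the induced metric, computed in the preferred chart at `x`:
`∇_v Y = ∑ₖ (∑ᵢ vⁱ (∂ᵢ Yᵏ + ∑ⱼ Γᵏᵢⱼ Yʲ)) ∂ₖ`. -/
def covDeriv (g : L → UnitSphere n) (x : L) (v : TangentSpace (𝓡 2) x)
    (Y : ∀ x : L, TangentSpace (𝓡 2) x) : TangentSpace (𝓡 2) x :=
  show EuclideanSpace ℝ (Fin 2) from WithLp.toLp 2 fun k =>
    ∑ i, comp v i * (pd i (localField x Y k) (extChartAt (𝓡 2) x x)
      + ∑ j, christoffel (localMetric g x) k i j (extChartAt (𝓡 2) x x) * comp (Y x) j)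

/-- The coefficient `α_g(∂ᵢ, ∂ⱼ)` at `x` of the second fundamental form of `g` in `𝕊ⁿ`, in the
preferred chart at `x`. By the Gauss formulas of `g` in `𝕊ⁿ` and of `𝕊ⁿ` in `ℝⁿ⁺¹`,
`∂ᵢ ∂ⱼ g = ∑ₖ Γᵏᵢⱼ ∂ₖ g + α_g(∂ᵢ, ∂ⱼ) - ⟨∂ᵢ, ∂ⱼ⟩ g`. -/
def secondFormCoeff (g : L → UnitSphere n) (x : L) (i j : Fin 2) :
    EuclideanSpace ℝ (Fin (n + 1)) :=
  pd i (pd j (localPosition g x)) (extChartAt (𝓡 2) x x)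
    - ∑ k, christoffel (localMetric g x) k i j (extChartAt (𝓡 2) x x) •
        pd k (localPosition g x) (extChartAt (𝓡 2) x x)
    + localMetric g x (extChartAt (𝓡 2) x x) i j • position g x

/-- The second fundamental form `α_g(v, w)` of `g` in `𝕊ⁿ` at `x`, a vector of `ℝⁿ⁺¹`. -/
def secondForm (g : L → UnitSphere n) (x : L) (v w : TangentSpace (𝓡 2) x) :
    EuclideanSpace ℝ (Fin (n + 1)) :=
  ∑ i, ∑ j, (comp v i * comp w j) • secondFormCoeff g x i j

/-- `x` is an umbilic point of `g`: `α_g(v, w) = ⟨v, w⟩ ζ` for a fixed vector `ζ`; for a surface in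
`𝕊³` this says that the shape operator at `x` is a multiple of the identity. -/
def IsUmbilic (g : L → UnitSphere n) (x : L) : Prop :=
  ∃ ζ : EuclideanSpace ℝ (Fin (n + 1)), ∀ v w : TangentSpace (𝓡 2) x,
    secondForm g x v w = inducedMetric g x v w • ζ

/-- The restriction of the surface `g` to the open set `U ⊆ L` is a surface of type `D`: there are
smooth linearly independent vector fields `X, Y` on `U` with `‖Y‖ = 1`, `⟨X, Y⟩ ≠ 0`,
`∇ᵍ_X Y = 0` and `α_g(X, Y) = 0`. -/
def IsTypeDOn [IsManifold (𝓡 2) ∞ L] (g : L → UnitSphere n) (U : Set L) : Prop :=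
  ∃ X Y : ∀ x : L, TangentSpace (𝓡 2) x,
    ContMDiffOn (𝓡 2) (𝓡 2).tangent ∞
      (fun x => (⟨x, X x⟩ : TangentBundle (𝓡 2) L)) U ∧
    ContMDiffOn (𝓡 2) (𝓡 2).tangent ∞
      (fun x => (⟨x, Y x⟩ : TangentBundle (𝓡 2) L)) U ∧
    ∀ x ∈ U,
      LinearIndependent ℝ ![X x, Y x] ∧
      inducedMetric g x (Y x) (Y x) = 1 ∧
      inducedMetric g x (X x) (Y x) ≠ 0 ∧
      covDeriv g x (X x) Y = 0 ∧
      secondForm g x (X x) (Y x) = 0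

end Surface

end SphereSurface

end

/-!
At a point that is not umbilic the second fundamental form `α` is not a multiple of the metric, so
near it there are directions `Z` whose conjugate direction `X` (that is, `α(X, Z) = 0`) is neither
parallel nor orthogonal to `Z` (`exists_slope`). Looking for `Y` as the normalization of
`Z = ∂₀ + τ ∂₁` with an unknown slope `τ`, and for `X` as the conjugate direction of `Z`, all
conditions hold for every `τ` close to a suitable constant, except `∇_X Y = 0`. Since `‖Y‖ = 1`, the
latter only says that `∇_X Z` has no component orthogonal to `Z`. This is a single quasilinear
equation `dτ(X(u, τ)) = c(u, τ)` of first order for `τ`, and as `X ≠ 0` it has local solutions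
(`exists_quasilinear_solution`, `exists_conjugate_fields`).

The quasilinear equation is solved by characteristics. This needs a flow that is smooth in the initial
point, `exists_contDiffOn_flow`: the inverse function theorem is applied in the Banach space of
continuous curves to the map `(t, x, γ) ↦ (t, x, γ - x - t ∫ v(γ))`, which is smooth because
composition with a smooth map is a smooth operator on spaces of continuous maps
(`contDiff_postcomp`).

All of this takes place in the chart at the given point. The conditions `∇_X Y = 0` and `α(X, Y) = 0`
at the other points refer to the charts at those points. They are transported in the invariant form
that the derivative of `g_* Y` along `X`, as a map into `ℝ⁴`, equals `-⟨X, Y⟩ g`. In any chart the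
Gauss formula splits that derivative into `g_* ∇_X Y`, `α(X, Y)` and `-⟨X, Y⟩ g`, and the first two
are orthogonal (`IsSurface.covDeriv_eq_zero_and_secondForm_eq_zero`).
-/

noncomputable section

namespace SphereSurface

open Set Filter Topology

/-! ### Smooth local inverses -/

/-- Inverse function theorem with a smooth inverse on a whole neighbourhood: `ContDiffAt ℝ ∞` for
the inverse at the image point alone would not give that, since the neighbourhoods on which it is
`n` times differentiable may shrink with `n`. -/
theorem exists_openPartialHomeomorph_contDiffOn_symm {E F : Type*}
    [NormedAddCommGroup E] [NormedSpace ℝ E] [CompleteSpace E]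
    [NormedAddCommGroup F] [NormedSpace ℝ F]
    {f : E → F} {s : Set E} (hs : IsOpen s) (hf : ContDiffOn ℝ ∞ f s) {a : E} (ha : a ∈ s)
    (f' : E ≃L[ℝ] F) (hf' : HasFDerivAt f (f' : E →L[ℝ] F) a) :
    ∃ e : OpenPartialHomeomorph E F, (e : E → F) = f ∧ a ∈ e.source ∧ e.source ⊆ s ∧
      ContDiffOn ℝ ∞ e.symm e.target := by
  have hfa : ContDiffAt ℝ ∞ f a := hf.contDiffAt (hs.mem_nhds ha)
  let e₀ := hfa.toOpenPartialHomeomorph f hf' (by simp)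
  let t : Set E := s ∩ fderiv ℝ f ⁻¹' range ((↑) : (E ≃L[ℝ] F) → E →L[ℝ] F)
  have ht : IsOpen t :=
    (hf.continuousOn_fderiv_of_isOpen hs (by simp)).isOpen_inter_preimage hs
      (ContinuousLinearEquiv.isOpen)
  have hat : a ∈ t := ⟨ha, f', hf'.fderiv.symm⟩
  refine ⟨e₀.restrOpen t ht, rfl, ⟨hfa.mem_toOpenPartialHomeomorph_source hf' (by simp), hat⟩,
    fun x hx => hx.2.1, fun y hy => ?_⟩
  have hx := (e₀.restrOpen t ht).map_target hy
  set x := (e₀.restrOpen t ht).symm y with hxdef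
  obtain ⟨f₁', hf₁'⟩ := hx.2.2
  have hfx : ContDiffAt ℝ ∞ f x := hf.contDiffAt (hs.mem_nhds hx.2.1)
  refine ((e₀.restrOpen t ht).contDiffAt_symm (f₀' := f₁') hy ?_ hfx).contDiffWithinAt
  have := (hfx.differentiableAt (by simp)).hasFDerivAt
  rw [← hf₁'] at this
  exact this

/-! ### Smoothness of the composition operator on spaces of continuous maps -/

section Composition

universe u

variable {K : Type*} [TopologicalSpace K] [CompactSpace K]

/-- Pointwise application of a continuous family of operators to a continuous map, as a bounded
linear map of the family. -/
def pointwiseApply (E F : Type u) [NormedAddCommGroup E] [NormedSpace ℝ E]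
    [NormedAddCommGroup F] [NormedSpace ℝ F] :
    C(K, E →L[ℝ] F) →L[ℝ] C(K, E) →L[ℝ] C(K, F) :=
  LinearMap.mkContinuous₂
    (LinearMap.mk₂ ℝ (fun (A : C(K, E →L[ℝ] F)) (h : C(K, E)) =>
        (⟨fun s => A s (h s), A.continuous.clm_apply h.continuous⟩ : C(K, F)))
      (fun _ _ _ => by ext; simp) (fun _ _ _ => by ext; simp)
      (fun _ _ _ => by ext; simp) (fun _ _ _ => by ext; simp)) 1
    (fun A h => by
      rw [one_mul]
      refine (ContinuousMap.norm_le _ (by positivity)).2 fun s => ?_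
      exact ((A s).le_opNorm (h s)).trans
        (mul_le_mul (A.norm_coe_le_norm s) (h.norm_coe_le_norm s) (norm_nonneg _)
          (by positivity)))

@[simp]
theorem pointwiseApply_apply {E F : Type u} [NormedAddCommGroup E] [NormedSpace ℝ E]
    [NormedAddCommGroup F] [NormedSpace ℝ F] (A : C(K, E →L[ℝ] F)) (h : C(K, E)) (s : K) :
    pointwiseApply E F A h s = A s (h s) := rfl

theorem hasFDerivAt_postcomp {E F : Type u} [NormedAddCommGroup E] [NormedSpace ℝ E]
    [NormedAddCommGroup F] [NormedSpace ℝ F] (f : C(E, F)) (f' : C(E, E →L[ℝ] F))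
    (hf : ∀ x, HasFDerivAt f (f' x) x) (γ : C(K, E)) :
    HasFDerivAt (fun γ : C(K, E) => f.comp γ) (pointwiseApply E F (f'.comp γ)) γ := by
  rw [hasFDerivAt_iff_isLittleO_nhds_zero, Asymptotics.isLittleO_iff]
  intro c hc
  -- Continuity of `γ ↦ f' ∘ γ` gives the uniformity in the mean value inequality.
  have hcont : Continuous fun γ : C(K, E) => f'.comp γ := ContinuousMap.continuous_postcomp f'
  obtain ⟨δ, hδ, hball⟩ := (Metric.continuousAt_iff (α := C(K, E))
    (β := C(K, E →L[ℝ] F))).1 (hcont.continuousAt (x := γ)) c hc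
  filter_upwards [Metric.ball_mem_nhds (0 : C(K, E)) hδ] with h hh
  rw [mem_ball_zero_iff] at hh
  refine (ContinuousMap.norm_le _ (by positivity)).2 fun s => ?_
  have key : ∀ y ∈ segment ℝ (γ s) (γ s + h s), ‖f' y - f' (γ s)‖ ≤ c := by
    intro y hy
    rw [segment_eq_image'] at hy
    obtain ⟨r, hr, rfl⟩ := hy
    have hd : dist (γ + r • h) γ < δ := by
      rw [dist_eq_norm, add_sub_cancel_left, norm_smul, Real.norm_eq_abs, abs_of_nonneg hr.1]
      exact (mul_le_of_le_one_left (norm_nonneg _) hr.2).trans_lt hh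
    have := (ContinuousMap.dist_lt_iff hc).1 (hball hd) s
    rw [dist_eq_norm] at this
    simpa using this.le
  have := (convex_segment (γ s) (γ s + h s)).norm_image_sub_le_of_norm_hasFDerivWithin_le'
    (f := f) (f' := f') (φ := f' (γ s)) (fun x _ => (hf x).hasFDerivWithinAt) key
    (left_mem_segment ℝ _ _) (right_mem_segment ℝ _ _)
  rw [add_sub_cancel_left] at this
  refine (le_of_eq ?_).trans (this.trans
    (mul_le_mul_of_nonneg_left (h.norm_coe_le_norm s) hc.le))
  simp

/-- By induction on `n`: the derivative of `γ ↦ f ∘ γ` is a bounded linear function of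
`γ ↦ f' ∘ γ`. The spaces are quantified inside the induction since `f'` takes values in a different
space than `f`. -/
theorem contDiff_nat_postcomp (n : ℕ) : ∀ {E F : Type u} [NormedAddCommGroup E] [NormedSpace ℝ E]
    [NormedAddCommGroup F] [NormedSpace ℝ F] (f : C(E, F)), ContDiff ℝ n f →
    ContDiff ℝ n (fun γ : C(K, E) => f.comp γ) := by
  induction n with
  | zero =>
    intro E F _ _ _ _ f _
    exact contDiff_zero.2 (ContinuousMap.continuous_postcomp f)
  | succ n ih =>
    intro E F _ _ _ _ f hf
    have hf1 : ContDiff ℝ n (fderiv ℝ f) := hf.fderiv_right (by simp)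
    let f' : C(E, E →L[ℝ] F) := ⟨fderiv ℝ f, hf1.continuous⟩
    have hd : ∀ x, HasFDerivAt f (f' x) x := fun x =>
      ((hf.differentiable (by simp)) x).hasFDerivAt
    refine (contDiff_succ_iff_hasFDerivAt (n := n)).2
      ⟨fun γ => pointwiseApply E F (f'.comp γ), ?_, hasFDerivAt_postcomp f f' hd⟩
    exact (pointwiseApply E F).contDiff.comp (ih f' hf1)

theorem contDiff_postcomp {E F : Type u} [NormedAddCommGroup E] [NormedSpace ℝ E]
    [NormedAddCommGroup F] [NormedSpace ℝ F] (f : C(E, F)) (hf : ContDiff ℝ ∞ f) :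
    ContDiff ℝ ∞ (fun γ : C(K, E) => f.comp γ) :=
  contDiff_infty.2 fun n => contDiff_nat_postcomp n f (hf.of_le (by exact_mod_cast le_top))

end Composition

/-! ### The flow of a smooth vector field depends smoothly on the initial point -/

section Flow

variable {E : Type*} [NormedAddCommGroup E] [NormedSpace ℝ E]

/-- The primitive `s ↦ ∫₀ˢ β`, as a bounded linear operator on continuous curves. -/
def primitive : C(Icc (0 : ℝ) 1, E) →L[ℝ] C(Icc (0 : ℝ) 1, E) :=
  LinearMap.mkContinuous
    { toFun := fun β =>
        ⟨fun s => ∫ τ in (0 : ℝ)..s, IccExtend zero_le_one β τ,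
          (intervalIntegral.continuous_primitive
            (fun _ _ => (β.continuous.Icc_extend' (h := zero_le_one)).intervalIntegrable _ _)
            0).comp continuous_subtype_val⟩
      map_add' := fun β β' => by
        ext s
        exact intervalIntegral.integral_add
          ((β.continuous.Icc_extend' (h := zero_le_one)).intervalIntegrable _ _)
          ((β'.continuous.Icc_extend' (h := zero_le_one)).intervalIntegrable _ _)
      map_smul' := fun c β => by
        ext s
        exact intervalIntegral.integral_smul c _ } 1
    (fun β => by
      rw [one_mul]
      refine (ContinuousMap.norm_le _ (norm_nonneg _)).2 fun s => ?_
      refine (intervalIntegral.norm_integral_le_of_norm_le_const (C := ‖β‖)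
        fun τ _ => β.norm_coe_le_norm _).trans ?_
      refine mul_le_of_le_one_right (norm_nonneg _) ?_
      rw [sub_zero, abs_of_nonneg s.2.1]
      exact s.2.2)

theorem primitive_apply (β : C(Icc (0 : ℝ) 1, E)) (s : Icc (0 : ℝ) 1) :
    primitive β s = ∫ τ in (0 : ℝ)..s, IccExtend zero_le_one β τ := rfl

/-- The constant curves, as a bounded linear operator. -/
def constCurve : E →L[ℝ] C(Icc (0 : ℝ) 1, E) := ContinuousLinearMap.const ℝ (Icc (0 : ℝ) 1)

@[simp]
theorem constCurve_apply (x : E) (s : Icc (0 : ℝ) 1) : constCurve x s = x := rfl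

/-- The map `(t, x, γ) ↦ (t, x, γ - x - t ∫₀ v(γ))`; the last entry vanishes when
`γ(s) = φ(st, x)` for the flow `φ` of `v`. -/
def picardDefect (v : C(E, E)) (q : (ℝ × E) × C(Icc (0 : ℝ) 1, E)) :
    (ℝ × E) × C(Icc (0 : ℝ) 1, E) :=
  (q.1, q.2 - (constCurve q.1.2 + q.1.1 • primitive (v.comp q.2)))

theorem contDiff_picardDefect (v : C(E, E)) (hv : ContDiff ℝ ∞ v) :
    ContDiff ℝ ∞ (picardDefect v) := by
  have h : ContDiff ℝ ∞ fun γ : C(Icc (0 : ℝ) 1, E) => v.comp γ := contDiff_postcomp v hv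
  refine contDiff_fst.prodMk (contDiff_snd.sub (ContDiff.add ?_ ?_))
  · exact (constCurve (E := E)).contDiff.comp
      (contDiff_snd.comp contDiff_fst)
  · exact (contDiff_fst.comp contDiff_fst).smul
      (primitive.contDiff.comp (h.comp contDiff_snd))

/-- At `t = 0` the differential of `picardDefect` is a shear, hence invertible. -/
theorem hasFDerivAt_picardDefect (v : C(E, E)) (hv : ContDiff ℝ ∞ v) (x₀ : E) :
    ∃ A : ((ℝ × E) × C(Icc (0 : ℝ) 1, E)) ≃L[ℝ] ((ℝ × E) × C(Icc (0 : ℝ) 1, E)),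
      HasFDerivAt (picardDefect v) (A : _ →L[ℝ] _)
        (((0 : ℝ), x₀), constCurve x₀) := by
  set q₀ : (ℝ × E) × C(Icc (0 : ℝ) 1, E) := (((0 : ℝ), x₀), constCurve x₀) with hq₀
  have hw : HasFDerivAt (fun q : (ℝ × E) × C(Icc (0 : ℝ) 1, E) => primitive (v.comp q.2))
      (fderiv ℝ (fun q : (ℝ × E) × C(Icc (0 : ℝ) 1, E) => primitive (v.comp q.2)) q₀) q₀ := by
    have h : ContDiff ℝ ∞ fun γ : C(Icc (0 : ℝ) 1, E) => v.comp γ := contDiff_postcomp v hv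
    have h' : ContDiff ℝ ∞
        (fun q : (ℝ × E) × C(Icc (0 : ℝ) 1, E) => primitive (v.comp q.2)) :=
      primitive.contDiff.comp (h.comp contDiff_snd)
    exact (h'.differentiable (by simp) q₀).hasFDerivAt
  have h1 : HasFDerivAt (fun q : (ℝ × E) × C(Icc (0 : ℝ) 1, E) => q.1.1)
      ((ContinuousLinearMap.fst ℝ ℝ E).comp (ContinuousLinearMap.fst ℝ _ _)) q₀ :=
    hasFDerivAt_fst.comp q₀ hasFDerivAt_fst
  have h2' : HasFDerivAt (fun q : (ℝ × E) × C(Icc (0 : ℝ) 1, E) => q.1.2)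
      ((ContinuousLinearMap.snd ℝ ℝ E).comp (ContinuousLinearMap.fst ℝ _ _)) q₀ :=
    hasFDerivAt_snd.comp q₀ hasFDerivAt_fst
  have h2 : HasFDerivAt (fun q : (ℝ × E) × C(Icc (0 : ℝ) 1, E) =>
      constCurve q.1.2)
      (constCurve.comp
        ((ContinuousLinearMap.snd ℝ ℝ E).comp (ContinuousLinearMap.fst ℝ _ _))) q₀ :=
    (constCurve (E := E)).hasFDerivAt.comp q₀ h2'
  let T : (ℝ × E) →L[ℝ] C(Icc (0 : ℝ) 1, E) :=
    -(constCurve.comp (ContinuousLinearMap.snd ℝ ℝ E)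
      + (ContinuousLinearMap.fst ℝ ℝ E).smulRight (primitive (v.comp q₀.2)))
  refine ⟨(ContinuousLinearEquiv.refl ℝ _).skewProd (ContinuousLinearEquiv.refl ℝ _) T, ?_⟩
  have := (hasFDerivAt_fst (𝕜 := ℝ) (p := q₀)).prodMk
    ((hasFDerivAt_snd (𝕜 := ℝ) (p := q₀)).sub (h2.add (h1.smul hw)))
  refine this.congr_fderiv ?_
  refine ContinuousLinearMap.ext fun q => ?_
  refine Prod.ext rfl ?_
  simp [T, q₀]
  abel

/-- A smooth vector field has a local flow which is smooth in time and initial point jointly. The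
flow itself is that of the Picard–Lindelöf theorem; it is smooth because the curve
`s ↦ φ(st, x)` is the solution near the constant curve `x₀` of `picardDefect v = (t, x, 0)`,
to which the inverse function theorem applies. -/
theorem exists_contDiffOn_flow [CompleteSpace E] (v : E → E) (hv : ContDiff ℝ ∞ v) (x₀ : E) :
    ∃ (φ : ℝ × E → E) (N : Set (ℝ × E)), IsOpen N ∧ (0, x₀) ∈ N ∧ ContDiffOn ℝ ∞ φ N ∧
      (∀ x, (0, x) ∈ N → φ (0, x) = x) ∧
      ∀ t x, (t, x) ∈ N → HasDerivAt (fun s => φ (s, x)) (v (φ (t, x))) t := by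
  let vc : C(E, E) := ⟨v, hv.continuous⟩
  obtain ⟨A, hA⟩ := hasFDerivAt_picardDefect vc hv x₀
  obtain ⟨e, he, hq₀, -, hsymm⟩ := exists_openPartialHomeomorph_contDiffOn_symm isOpen_univ
    (contDiff_picardDefect vc hv).contDiffOn (mem_univ _) A hA
  obtain ⟨ε, hε, a, r, L, K, hr, hPL⟩ :=
    IsPicardLindelof.of_contDiffAt_one (hv.contDiffAt (x := x₀) |>.of_le (by simp))
  obtain ⟨α, hα, hαc⟩ := (hPL 0).exists_forall_mem_closedBall_eq_hasDerivWithinAt_continuousOn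
  simp only [zero_sub, zero_add] at hα hαc
  have hr' : (0 : ℝ) < r := hr
  have hderiv : ∀ x ∈ Metric.closedBall x₀ (r : ℝ), ∀ t ∈ Ioo (-ε) ε,
      HasDerivAt (fun s => α (x, s)) (v (α (x, t))) t := fun x hx t ht =>
    ((hα x hx).2 t (Ioo_subset_Icc_self ht)).hasDerivAt (Icc_mem_nhds ht.1 ht.2)
  -- Points `((t, x), γ)` with `(t, x)` near `(0, x₀)` and `γ` near the constant curve lie in the
  -- domain of the local inverse.
  obtain ⟨δ, hδ, hδe⟩ := Metric.isOpen_iff.1 e.open_source _ hq₀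
  have hαx₀ : ContinuousAt α (x₀, 0) := hαc.continuousAt
    (prod_mem_nhds (Metric.closedBall_mem_nhds _ hr') (Icc_mem_nhds (by linarith) hε))
  obtain ⟨ρ, hρ, hαρ⟩ := Metric.continuousAt_iff.1 hαx₀ (δ / 2) (by positivity)
  rw [(hα x₀ (Metric.mem_closedBall_self hr'.le)).1] at hαρ
  obtain ⟨κ, hκ0, hκε, hκr, hκρ, hκδ⟩ :
      ∃ κ : ℝ, 0 < κ ∧ κ ≤ ε ∧ κ ≤ r ∧ κ ≤ ρ ∧ κ ≤ δ / 2 :=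
    ⟨min (min ε r) (min ρ (δ / 2)), by positivity, by simp, by simp, by simp, by simp⟩
  have hmem : ∀ t x, (t, x) ∈ Metric.ball ((0 : ℝ), x₀) κ →
      ∃ γ : C(Icc (0 : ℝ) 1, E), (∀ s, γ s = α (x, t * s)) ∧ ((t, x), γ) ∈ e.source ∧
        e ((t, x), γ) = ((t, x), 0) := by
    intro t x htx
    rw [← ball_prod_same] at htx
    obtain ⟨ht, hx⟩ := htx
    simp only [Metric.mem_ball, dist_zero_right, Real.norm_eq_abs] at ht hx
    have hts : ∀ s ∈ Icc (0 : ℝ) 1, |t * s| < κ := fun s hs => by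
      rw [abs_mul, abs_of_nonneg hs.1]
      exact (mul_le_of_le_one_right (abs_nonneg t) hs.2).trans_lt ht
    have hxr : x ∈ Metric.closedBall x₀ (r : ℝ) := (hx.le.trans hκr)
    have htε : ∀ s ∈ Icc (0 : ℝ) 1, t * s ∈ Ioo (-ε) ε := fun s hs =>
      abs_lt.1 ((hts s hs).trans_le hκε)
    have hd : ∀ s ∈ Icc (0 : ℝ) 1,
        HasDerivAt (fun s => α (x, t * s)) (t • v (α (x, t * s))) s := fun s hs => by
      have h1 : HasDerivAt (fun s : ℝ => t * s) t s := by
        simpa using (hasDerivAt_id s).const_mul t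
      exact (hderiv x hxr _ (htε s hs)).scomp s h1
    have hcont : ContinuousOn (fun s => α (x, t * s)) (Icc (0 : ℝ) 1) := fun s hs =>
      (hd s hs).continuousAt.continuousWithinAt
    let γ : C(Icc (0 : ℝ) 1, E) := ⟨fun s => α (x, t * s), hcont.domRestrict⟩
    refine ⟨γ, fun s => rfl, hδe ?_, ?_⟩
    · rw [Metric.mem_ball, Prod.dist_eq, Prod.dist_eq, max_lt_iff, max_lt_iff]
      refine ⟨⟨?_, by linarith⟩, ?_⟩
      · rw [dist_zero_right, Real.norm_eq_abs]; linarith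
      · refine ((ContinuousMap.dist_le (C := δ / 2) (by positivity)).2 fun s => ?_).trans_lt
          (by linarith)
        refine (hαρ (x := (x, t * s)) ?_).le
        rw [Prod.dist_eq, max_lt_iff]
        refine ⟨hx.trans_le hκρ, ?_⟩
        rw [dist_zero_right, Real.norm_eq_abs]
        exact (hts s s.2).trans_le hκρ
    · rw [he]
      refine Prod.ext rfl ?_
      ext s
      have hint : ∫ τ in (0 : ℝ)..s, t • IccExtend zero_le_one (vc.comp γ) τ
          = α (x, t * s) - α (x, t * 0) := by
        refine (intervalIntegral.integral_congr (g := fun τ => t • v (α (x, t * τ)))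
          fun τ hτ => ?_).trans
          (intervalIntegral.integral_eq_sub_of_hasDerivAt (fun τ hτ => hd τ ?_) ?_)
        · rw [uIcc_of_le s.2.1] at hτ
          simp only [IccExtend_of_mem zero_le_one _ (⟨hτ.1, hτ.2.trans s.2.2⟩ : τ ∈ Icc (0 : ℝ) 1)]
          rfl
        · rw [uIcc_of_le s.2.1] at hτ
          exact ⟨hτ.1, hτ.2.trans s.2.2⟩
        · refine ContinuousOn.intervalIntegrable ?_
          rw [uIcc_of_le s.2.1]
          exact continuousOn_const.smul (hv.continuous.comp_continuousOn
            (hcont.mono (Icc_subset_Icc_right s.2.2)))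
      rw [intervalIntegral.integral_smul, mul_zero, (hα x hxr).1] at hint
      change α (x, t * s) - (x + t • primitive (vc.comp γ) s) = 0
      rw [primitive_apply, hint]
      abel
  refine ⟨fun q => α (q.2, q.1), Metric.ball (0, x₀) κ, Metric.isOpen_ball,
    Metric.mem_ball_self hκ0, ?_, ?_, ?_⟩
  · have hsm : ContDiffOn ℝ ∞ (fun q : ℝ × E => (e.symm (q, 0)).2 ⟨1, by simp⟩)
        (Metric.ball (0, x₀) κ) := by
      refine (ContinuousMap.evalCLM ℝ (⟨1, by simp⟩ : Icc (0 : ℝ) 1)).contDiff.comp_contDiffOn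
        (contDiff_snd.comp_contDiffOn (hsymm.comp
          (contDiff_id.prodMk contDiff_const).contDiffOn ?_))
      rintro ⟨t, x⟩ htx
      obtain ⟨γ, -, hγ, heq⟩ := hmem t x htx
      change ((t, x), 0) ∈ e.target
      rw [← heq]
      exact e.map_source hγ
    refine hsm.congr ?_
    rintro ⟨t, x⟩ htx
    obtain ⟨γ, hγα, hγ, heq⟩ := hmem t x htx
    rw [← heq, e.left_inv hγ]
    simp [hγα]
  · intro x hx
    rw [← ball_prod_same] at hx
    exact (hα x (hx.2.le.trans hκr)).1
  · intro t x htx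
    rw [← ball_prod_same] at htx
    obtain ⟨ht, hx⟩ := htx
    simp only [Metric.mem_ball, dist_zero_right, Real.norm_eq_abs] at ht hx
    exact hderiv x (hx.le.trans hκr) t (abs_lt.1 (ht.trans_le hκε))

/-- A smooth map on an open set agrees near each of its points with a smooth map defined on the
whole space. -/
theorem exists_contDiff_eventuallyEq {F : Type*} [NormedAddCommGroup F] [NormedSpace ℝ F]
    [HasContDiffBump E] {v : E → F} {s : Set E} (hs : IsOpen s)
    (hv : ContDiffOn ℝ ∞ v s) {x₀ : E} (hx₀ : x₀ ∈ s) :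
    ∃ w : E → F, ContDiff ℝ ∞ w ∧ w =ᶠ[𝓝 x₀] v := by
  obtain ⟨ε, hε, hball⟩ := Metric.isOpen_iff.1 hs x₀ hx₀
  let b : ContDiffBump x₀ := ⟨ε / 3, ε / 2, by positivity, by linarith⟩
  refine ⟨fun x => b x • v x, contDiff_iff_contDiffAt.2 fun x => ?_, ?_⟩
  · by_cases hx : x ∈ s
    · exact b.contDiffAt.smul (hv.contDiffAt (hs.mem_nhds hx))
    · refine contDiffAt_const (c := 0) |>.congr_of_eventuallyEq ?_
      have hx' : x ∈ (Metric.closedBall x₀ (ε / 2))ᶜ := fun h =>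
        hx (hball (Metric.closedBall_subset_ball (by linarith) h))
      filter_upwards [Metric.isClosed_closedBall.isOpen_compl.mem_nhds hx'] with y hy
      have : b y = 0 := b.zero_of_le_dist (by
        simp only [mem_compl_iff, Metric.mem_closedBall, not_le] at hy; exact hy.le)
      simp [this]
  · filter_upwards [b.eventuallyEq_one] with y hy
    simp only [Pi.one_apply] at hy
    simp [hy]

end Flow

/-! ### Quasilinear first-order equations in the plane -/

/-- A nonzero vector of the plane is part of a basis. -/
theorem exists_equiv_apply_eq_smul_add_smul {b : Plane} (hb : b ≠ 0) :
    ∃ (d : Plane) (A : (ℝ × ℝ) ≃L[ℝ] Plane), ∀ q : ℝ × ℝ, A q = q.1 • b + q.2 • d := by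
  let d : Plane := !₂[-b 1, b 0]
  let A : ℝ × ℝ →ₗ[ℝ] Plane :=
    (LinearMap.fst ℝ ℝ ℝ).smulRight b + (LinearMap.snd ℝ ℝ ℝ).smulRight d
  have hpos : 0 < b 0 ^ 2 + b 1 ^ 2 := by
    rcases (add_nonneg (sq_nonneg (b 0)) (sq_nonneg (b 1))).lt_or_eq with h | h
    · exact h
    · refine absurd ?_ hb
      ext i
      fin_cases i
      · simp only [Fin.zero_eta, PiLp.zero_apply]; nlinarith
      · simp only [Fin.mk_one, PiLp.zero_apply]; nlinarith
  have hA : Function.Injective A := by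
    rw [← LinearMap.ker_eq_bot, LinearMap.ker_eq_bot']
    intro q hq
    have h0 : q.1 * b 0 - q.2 * b 1 = 0 := by
      have := congrArg (fun w : Plane => w 0) hq
      simpa [A, d, sub_eq_add_neg] using this
    have h1 : q.1 * b 1 + q.2 * b 0 = 0 := by
      have := congrArg (fun w : Plane => w 1) hq
      simpa [A, d] using this
    refine Prod.ext ?_ ?_
    · refine (mul_eq_zero.1 (?_ : q.1 * (b 0 ^ 2 + b 1 ^ 2) = 0)).resolve_right hpos.ne'
      linear_combination b 0 * h0 + b 1 * h1
    · refine (mul_eq_zero.1 (?_ : q.2 * (b 0 ^ 2 + b 1 ^ 2) = 0)).resolve_right hpos.ne'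
      linear_combination b 0 * h1 - b 1 * h0
  have hdim : Module.finrank ℝ (ℝ × ℝ) = Module.finrank ℝ Plane := by simp
  exact ⟨d, (LinearEquiv.ofInjectiveOfFinrankEq A hA hdim).toContinuousLinearEquiv, fun q => rfl⟩

/-- **Method of characteristics.** Where `a ≠ 0`, the equation `dτ(a(u, τ)) = c(u, τ)` has smooth
local solutions `τ` with a prescribed value at a point. The graph of `τ` is swept out by the integral
curves of `(a, c)` that start on a line transverse to `a`, at height `τ₀`. -/
theorem exists_quasilinear_solution {Ω : Set (Plane × ℝ)} (hΩ : IsOpen Ω)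
    {a : Plane × ℝ → Plane} {c : Plane × ℝ → ℝ} (ha : ContDiffOn ℝ ∞ a Ω)
    (hc : ContDiffOn ℝ ∞ c Ω) {u₀ : Plane} {τ₀ : ℝ} (h₀ : (u₀, τ₀) ∈ Ω)
    (hne : a (u₀, τ₀) ≠ 0) :
    ∃ (W : Set Plane) (τ : Plane → ℝ), IsOpen W ∧ u₀ ∈ W ∧ ContDiffOn ℝ ∞ τ W ∧ τ u₀ = τ₀ ∧
      ∀ u ∈ W, (u, τ u) ∈ Ω ∧ fderiv ℝ τ u (a (u, τ u)) = c (u, τ u) := by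
  obtain ⟨w, hw, hweq⟩ := exists_contDiff_eventuallyEq hΩ (ha.prodMk hc) h₀
  obtain ⟨φ, N, hN, h0N, hφ, hφ0, hφd⟩ := exists_contDiffOn_flow w hw (u₀, τ₀)
  obtain ⟨Ω', hΩ'sub, hΩ', h0Ω'⟩ := mem_nhds_iff.1 (hweq.and (hΩ.mem_nhds h₀))
  obtain ⟨d, A, hA⟩ := exists_equiv_apply_eq_smul_add_smul hne
  -- The characteristic through the point `(u₀ + s d, τ₀)`, at time `t`, with `q = (t, s)`.
  let ι : ℝ × ℝ → ℝ × (Plane × ℝ) := fun q => (q.1, (u₀ + q.2 • d, τ₀))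
  have hι : ContDiff ℝ ∞ ι := by fun_prop
  let S : Set (ℝ × ℝ) := ι ⁻¹' (N ∩ φ ⁻¹' Ω')
  have hS : IsOpen S :=
    (hφ.continuousOn.isOpen_inter_preimage hN hΩ').preimage hι.continuous
  have hι0 : ι (0, 0) = (0, (u₀, τ₀)) := by simp [ι]
  have h0S : ((0 : ℝ), (0 : ℝ)) ∈ S := by
    refine ⟨?_, ?_⟩
    · rw [hι0]; exact h0N
    · rw [mem_preimage, hι0, hφ0 _ h0N]; exact h0Ω'
  have hφι : ContDiffOn ℝ ∞ (fun q => φ (ι q)) S :=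
    hφ.comp hι.contDiffOn fun q hq => hq.1
  let Ψ : ℝ × ℝ → Plane := fun q => (φ (ι q)).1
  have hΨ : ContDiffOn ℝ ∞ Ψ S := contDiff_fst.comp_contDiffOn hφι
  have hchar : ∀ t s, (t, s) ∈ S → HasDerivAt (fun t' => φ (ι (t', s)))
      (a (φ (ι (t, s))), c (φ (ι (t, s)))) t := by
    intro t s hts
    have h := hφd t (u₀ + s • d, τ₀) hts.1
    have h' : w (φ (ι (t, s))) = _ := (hΩ'sub hts.2).1
    change HasDerivAt _ (w (φ (ι (t, s)))) t at h
    rw [h'] at h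
    exact h
  have hΨd : HasFDerivAt Ψ (A : (ℝ × ℝ) →L[ℝ] Plane) (0, 0) := by
    have hdiff : HasFDerivAt Ψ (fderiv ℝ Ψ (0, 0)) (0, 0) :=
      ((hΨ.contDiffAt (hS.mem_nhds h0S)).differentiableAt (by simp)).hasFDerivAt
    have e1 : fderiv ℝ Ψ (0, 0) (1, 0) = a (u₀, τ₀) := by
      have h1 : HasDerivAt (fun t : ℝ => (t, (0 : ℝ))) ((1 : ℝ), (0 : ℝ)) 0 :=
        (hasDerivAt_id _).prodMk (hasDerivAt_const _ _)
      have h2 := (hasFDerivAt_fst (𝕜 := ℝ)).comp_hasDerivAt (0 : ℝ) (hchar 0 0 h0S)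
      have h3 := (hdiff.comp_hasDerivAt (f := fun t : ℝ => (t, (0 : ℝ))) (0 : ℝ) h1).unique h2
      rw [h3, hι0, hφ0 _ h0N]
      rfl
    have e2 : fderiv ℝ Ψ (0, 0) (0, 1) = d := by
      have h1 : HasDerivAt (fun s : ℝ => ((0 : ℝ), s)) ((0 : ℝ), (1 : ℝ)) 0 :=
        (hasDerivAt_const _ _).prodMk (hasDerivAt_id _)
      have h2 : HasDerivAt (fun s : ℝ => u₀ + s • d) ((1 : ℝ) • d) 0 :=
        ((hasDerivAt_id (0 : ℝ)).smul_const d).const_add u₀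
      have h3 : (fun s : ℝ => u₀ + s • d) =ᶠ[𝓝 0] Ψ ∘ fun s : ℝ => ((0 : ℝ), s) := by
        have : ∀ᶠ s : ℝ in 𝓝 0, ((0 : ℝ), s) ∈ S :=
          (Continuous.prodMk_right (0 : ℝ)).continuousAt.preimage_mem_nhds (hS.mem_nhds h0S)
        filter_upwards [this] with s hs
        simp only [Function.comp_apply, Ψ]
        rw [show ι (0, s) = (0, (u₀ + s • d, τ₀)) from rfl, hφ0 _ hs.1]
      rw [one_smul] at h2
      exact ((hdiff.comp_hasDerivAt (f := fun s : ℝ => ((0 : ℝ), s)) (0 : ℝ)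
        h1).congr_of_eventuallyEq h3).unique h2
    refine hdiff.congr_fderiv (ContinuousLinearMap.ext fun q => ?_)
    rw [show q = q.1 • ((1 : ℝ), (0 : ℝ)) + q.2 • ((0 : ℝ), (1 : ℝ)) by
      ext <;> simp, map_add, map_smul, map_smul, e1, e2]
    simp [hA]
  obtain ⟨e, he, h0e, heS, hsymm⟩ :=
    exists_openPartialHomeomorph_contDiffOn_symm hS hΨ h0S A hΨd
  have hΨ0 : e (0, 0) = u₀ := by
    rw [he]; simp only [Ψ]; rw [hι0, hφ0 _ h0N]
  have hmaps : MapsTo e.symm e.target S := fun u hu => heS (e.map_target hu)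
  have hτ : ContDiffOn ℝ ∞ (fun u => (φ (ι (e.symm u))).2) e.target :=
    contDiff_snd.comp_contDiffOn (hφι.comp hsymm hmaps)
  have hpair : ∀ u ∈ e.target, (u, (φ (ι (e.symm u))).2) = φ (ι (e.symm u)) := by
    intro u hu
    refine Prod.ext ?_ rfl
    have := e.right_inv hu
    rw [he] at this
    exact this.symm
  refine ⟨e.target, fun u => (φ (ι (e.symm u))).2, e.open_target, hΨ0 ▸ e.map_source h0e, hτ,
    ?_, fun u hu => ?_⟩
  · have hsymm0 : e.symm u₀ = (0, 0) := by rw [← hΨ0, e.left_inv h0e]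
    simp only [hsymm0, hι0, hφ0 _ h0N]
  · rw [hpair u hu]
    have hsrc := e.map_target hu
    refine ⟨(hΩ'sub (heS hsrc).2).2, ?_⟩
    have huΨ : Ψ (e.symm u) = u := by
      have := e.right_inv hu
      rwa [he] at this
    rcases hq : e.symm u with ⟨t, s⟩
    rw [hq] at hsrc huΨ
    have hd := hchar t s (heS hsrc)
    have hd1 :=
      (hasFDerivAt_fst (𝕜 := ℝ)).comp_hasDerivAt t hd
    have hd2 :=
      (hasFDerivAt_snd (𝕜 := ℝ)).comp_hasDerivAt t hd
    have hdτ := ((hτ.contDiffAt (e.open_target.mem_nhds hu)).differentiableAt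
      (by simp)).hasFDerivAt
    rw [← huΨ] at hdτ
    have hcomp := hdτ.comp_hasDerivAt (f := fun t' => Ψ (t', s)) t hd1
    rw [huΨ] at hcomp
    refine (hcomp.congr_of_eventuallyEq ?_).unique hd2 |>.trans rfl
    have : ∀ᶠ t' in 𝓝 t, (t', s) ∈ e.source :=
      (Continuous.prodMk_left s).continuousAt.preimage_mem_nhds (e.open_source.mem_nhds hsrc)
    filter_upwards [this] with t' ht'
    have hinv := e.left_inv ht'
    rw [he] at hinv
    simp only [Function.comp_apply]
    rw [hinv]

/-! ### Determinants in `ℝ⁴` -/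

/-- The determinant of four vectors of `ℝ⁴`. If `b, c, d` are linearly independent, the linear
form `det4 · b c d` is the inner product with a nonzero vector normal to them. -/
def det4 (a b c d : EuclideanSpace ℝ (Fin 4)) : ℝ :=
  (EuclideanSpace.basisFun (Fin 4) ℝ).toBasis.det ![a, b, c, d]

theorem det4_add (a a' b c d : EuclideanSpace ℝ (Fin 4)) :
    det4 (a + a') b c d = det4 a b c d + det4 a' b c d :=
  AlternatingMap.map_vecCons_add _ _ _ _

theorem det4_smul (r : ℝ) (a b c d : EuclideanSpace ℝ (Fin 4)) :
    det4 (r • a) b c d = r * det4 a b c d :=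
  AlternatingMap.map_vecCons_smul _ _ _ _

theorem det4_self_left (b c d : EuclideanSpace ℝ (Fin 4)) : det4 b b c d = 0 :=
  AlternatingMap.map_eq_zero_of_eq _ (i := 0) (j := 1) _ rfl (by decide)

theorem det4_self_middle (b c d : EuclideanSpace ℝ (Fin 4)) : det4 c b c d = 0 :=
  AlternatingMap.map_eq_zero_of_eq _ (i := 0) (j := 2) _ rfl (by decide)

theorem det4_self_right (b c d : EuclideanSpace ℝ (Fin 4)) : det4 d b c d = 0 :=
  AlternatingMap.map_eq_zero_of_eq _ (i := 0) (j := 3) _ rfl (by decide)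

theorem contDiffOn_det4 {E : Type*} [NormedAddCommGroup E] [NormedSpace ℝ E] {s : Set E}
    {a b c d : E → EuclideanSpace ℝ (Fin 4)} (ha : ContDiffOn ℝ ∞ a s)
    (hb : ContDiffOn ℝ ∞ b s) (hc : ContDiffOn ℝ ∞ c s) (hd : ContDiffOn ℝ ∞ d s) :
    ContDiffOn ℝ ∞ (fun x => det4 (a x) (b x) (c x) (d x)) s := by
  simp only [det4, Module.Basis.det_apply, Matrix.det_apply]
  refine ContDiffOn.sum fun σ _ => ContDiffOn.const_smul _ (contDiffOn_prod fun i _ => ?_)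
  simp only [Module.Basis.toMatrix_apply, OrthonormalBasis.coe_toBasis_repr_apply,
    EuclideanSpace.basisFun_repr]
  fin_cases i <;> simp <;> fun_prop

theorem notMem_span_of_inner_eq_zero {F : Type*} [NormedAddCommGroup F] [InnerProductSpace ℝ F]
    {ι : Type*} {w : ι → F} {v : F} (hv : v ≠ 0) (h : ∀ i, inner ℝ v (w i) = 0) :
    v ∉ Submodule.span ℝ (range w) := by
  intro hmem
  have : Submodule.span ℝ (range w) ≤ (Submodule.span ℝ {v})ᗮ := by
    rw [Submodule.span_le]
    rintro _ ⟨i, rfl⟩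
    exact Submodule.mem_orthogonal_singleton_iff_inner_right.2 (h i)
  exact hv (inner_self_eq_zero.1 (Submodule.mem_orthogonal_singleton_iff_inner_right.1 (this hmem)))

/-- The form `det4 · f x y` and the inner products with `f, x, y` determine a vector of `ℝ⁴`. -/
theorem eq_zero_of_det4_eq_zero {v f x y : EuclideanSpace ℝ (Fin 4)}
    (hxy : LinearIndependent ℝ ![x, y]) (hf : f ≠ 0) (hfx : inner ℝ f x = 0)
    (hfy : inner ℝ f y = 0) (hvf : inner ℝ v f = 0) (hvx : inner ℝ v x = 0)
    (hvy : inner ℝ v y = 0) (hdet : det4 v f x y = 0) : v = 0 := by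
  by_contra hv
  have h3 : LinearIndependent ℝ ![f, x, y] :=
    linearIndependent_finCons.2 ⟨hxy, notMem_span_of_inner_eq_zero hf
      (by intro i; fin_cases i <;> simpa)⟩
  have h4 : LinearIndependent ℝ ![v, f, x, y] :=
    linearIndependent_finCons.2 ⟨h3, notMem_span_of_inner_eq_zero hv
      (by intro i; fin_cases i <;> simpa)⟩
  have := (EuclideanSpace.basisFun (Fin 4) ℝ).toBasis.is_basis_iff_det.1
    ⟨h4, h4.span_eq_top_of_card_eq_finrank' (by simp)⟩
  exact this.ne_zero hdet

/-! ### Partial derivatives -/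

section Partial

variable {F : Type*} [NormedAddCommGroup F] [NormedSpace ℝ F]

theorem fderiv_eq_sum_pd (f : Plane → F) (u v : Plane) :
    fderiv ℝ f u v = v 0 • pd 0 f u + v 1 • pd 1 f u := by
  have : v = v 0 • EuclideanSpace.single 0 1 + v 1 • EuclideanSpace.single 1 1 := by
    ext i; fin_cases i <;> simp
  conv_lhs => rw [this]
  simp [pd]

theorem contDiffOn_pd {f : Plane → F} {V : Set Plane} (hV : IsOpen V) (hf : ContDiffOn ℝ ∞ f V)
    (i : Fin 2) : ContDiffOn ℝ ∞ (pd i f) V :=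
  (hf.fderiv_of_isOpen hV (by simp)).clm_apply contDiffOn_const

theorem pd_pd_comm {f : Plane → F} {u : Plane} (hf : ContDiffAt ℝ ∞ f u) (i j : Fin 2) :
    pd i (pd j f) u = pd j (pd i f) u := by
  have hd : DifferentiableAt ℝ (fderiv ℝ f) u :=
    (hf.fderiv_right (m := ∞) (by simp)).differentiableAt (by simp)
  have key : ∀ i j : Fin 2, pd i (pd j f) u =
      fderiv ℝ (fderiv ℝ f) u (EuclideanSpace.single i 1) (EuclideanSpace.single j 1) := by
    intro i j
    have := hd.hasFDerivAt.clm_apply (hasFDerivAt_const (EuclideanSpace.single j (1 : ℝ)) u)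
    refine (congrArg (fun A => A (EuclideanSpace.single i (1 : ℝ))) this.fderiv).trans ?_
    simp
  rw [key, key]
  exact (hf.isSymmSndFDerivAt (by simpa using ENat.LEInfty.out)).eq _ _

end Partial

/-- Two nonzero polynomials of degree at most two have a common non-root. -/
theorem exists_quadratics_ne_zero {a₀ a₁ a₂ b₀ b₁ b₂ : ℝ} (ha : ¬(a₀ = 0 ∧ a₁ = 0 ∧ a₂ = 0))
    (hb : ¬(b₀ = 0 ∧ b₁ = 0 ∧ b₂ = 0)) :
    ∃ τ : ℝ, a₀ + τ * a₁ + τ ^ 2 * a₂ ≠ 0 ∧ b₀ + τ * b₁ + τ ^ 2 * b₂ ≠ 0 := by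
  open Polynomial in
  by_contra! h
  let P : ℝ[X] := C a₀ + X * C a₁ + X ^ 2 * C a₂
  let Q : ℝ[X] := C b₀ + X * C b₁ + X ^ 2 * C b₂
  have hPQ : P * Q = 0 := Polynomial.funext fun τ => by
    simp only [P, Q, eval_mul, eval_add, eval_C, eval_X, eval_pow, eval_zero, mul_eq_zero]
    exact or_iff_not_imp_left.2 (h τ)
  rcases mul_eq_zero.1 hPQ with h0 | h0
  · refine ha ⟨?_, ?_, ?_⟩
    · simpa [P, coeff_X, coeff_C, coeff_X_pow] using congrArg (coeff · 0) h0
    · simpa [P, coeff_X, coeff_C, coeff_X_pow] using congrArg (coeff · 1) h0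
    · simpa [P, coeff_X, coeff_C, coeff_X_pow] using congrArg (coeff · 2) h0
  · refine hb ⟨?_, ?_, ?_⟩
    · simpa [Q, coeff_X, coeff_C, coeff_X_pow] using congrArg (coeff · 0) h0
    · simpa [Q, coeff_X, coeff_C, coeff_X_pow] using congrArg (coeff · 1) h0
    · simpa [Q, coeff_X, coeff_C, coeff_X_pow] using congrArg (coeff · 2) h0

/-! ### Immersions of plane domains into the three-sphere -/

/-- `f` is a smooth immersion of the open plane domain `V` into the unit sphere of `ℝ⁴`. -/
structure IsSphericalImmersionOn (f : Plane → EuclideanSpace ℝ (Fin 4)) (V : Set Plane) :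
    Prop where
  isOpen : IsOpen V
  contDiffOn : ContDiffOn ℝ ∞ f V
  inner_self : ∀ u ∈ V, inner ℝ (f u) (f u) = (1 : ℝ)
  linearIndependent : ∀ u ∈ V, LinearIndependent ℝ ![pd 0 f u, pd 1 f u]

/-- The second fundamental form of `f` in the direction of the normal vector that represents
`det4 · f ∂₀f ∂₁f`. -/
def normalForm (f : Plane → EuclideanSpace ℝ (Fin 4)) (i j : Fin 2) (u : Plane) : ℝ :=
  det4 (pd i (pd j f) u) (f u) (pd 0 f u) (pd 1 f u)

theorem gram_pos {F : Type*} [NormedAddCommGroup F] [InnerProductSpace ℝ F] {x y : F}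
    (h : LinearIndependent ℝ ![x, y]) :
    0 < inner ℝ x x * inner ℝ y y - inner ℝ x y * inner ℝ x y := by
  have hx : x ≠ 0 := h.ne_zero 0
  have hxx : 0 < inner ℝ x x := real_inner_self_pos.2 hx
  -- the component of `y` orthogonal to `x`, times `⟪x, x⟫`
  have hP : inner ℝ x x • y - inner ℝ x y • x ≠ 0 := by
    intro h0
    have := LinearIndependent.pair_iff.1 h (-inner ℝ x y) (inner ℝ x x) (by rw [← h0]; module)
    exact hxx.ne' this.2
  have h1 := real_inner_self_pos.2 hP
  have h2 : inner ℝ (inner ℝ x x • y - inner ℝ x y • x) (inner ℝ x x • y - inner ℝ x y • x)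
      = inner ℝ x x * (inner ℝ x x * inner ℝ y y - inner ℝ x y * inner ℝ x y) := by
    simp only [inner_sub_left, inner_sub_right, real_inner_smul_left, real_inner_smul_right,
      real_inner_comm x y]
    ring
  rw [h2] at h1
  exact pos_of_mul_pos_right h1 hxx.le

namespace IsSphericalImmersionOn

variable {f : Plane → EuclideanSpace ℝ (Fin 4)} {V : Set Plane}

theorem differentiableAt (hf : IsSphericalImmersionOn f V) {u : Plane} (hu : u ∈ V) :
    DifferentiableAt ℝ f u :=
  (hf.contDiffOn.contDiffAt (hf.isOpen.mem_nhds hu)).differentiableAt (by simp)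

theorem inner_fderiv (hf : IsSphericalImmersionOn f V) {u : Plane} (hu : u ∈ V) (v : Plane) :
    inner ℝ (f u) (fderiv ℝ f u v) = 0 := by
  have hd := (hf.differentiableAt hu).hasFDerivAt
  have h1 := hd.inner ℝ hd
  have h2 : (fun w => inner ℝ (f w) (f w)) =ᶠ[𝓝 u] fun _ => (1 : ℝ) := by
    filter_upwards [hf.isOpen.mem_nhds hu] with w hw using hf.inner_self w hw
  have h3 := h1.unique ((hasFDerivAt_const (1 : ℝ) u).congr_of_eventuallyEq h2)
  have h4 := congrArg (fun A => A v) h3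
  simpa [real_inner_comm] using h4

theorem ne_zero (hf : IsSphericalImmersionOn f V) {u : Plane} (hu : u ∈ V) : f u ≠ 0 := by
  intro h
  have := hf.inner_self u hu
  simp [h] at this

theorem contDiffOn_normalForm (hf : IsSphericalImmersionOn f V) (i j : Fin 2) :
    ContDiffOn ℝ ∞ (normalForm f i j) V :=
  contDiffOn_det4 (contDiffOn_pd hf.isOpen (contDiffOn_pd hf.isOpen hf.contDiffOn j) i)
    hf.contDiffOn (contDiffOn_pd hf.isOpen hf.contDiffOn 0)
    (contDiffOn_pd hf.isOpen hf.contDiffOn 1)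

theorem normalForm_comm (hf : IsSphericalImmersionOn f V) {u : Plane} (hu : u ∈ V) :
    normalForm f 1 0 u = normalForm f 0 1 u := by
  rw [normalForm, pd_pd_comm (hf.contDiffOn.contDiffAt (hf.isOpen.mem_nhds hu)), normalForm]

theorem inner_pd (hf : IsSphericalImmersionOn f V) {u : Plane} (hu : u ∈ V) (i : Fin 2) :
    inner ℝ (f u) (pd i f u) = 0 :=
  hf.inner_fderiv hu _

end IsSphericalImmersionOn

/-- The direction `-h(∂₁, Z) ∂₀ + h(∂₀, Z) ∂₁` for `h = normalForm` and `Z = ∂₀ + τ ∂₁`, with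
`q = (u, τ)`; it is conjugate to `Z`, that is, `h` vanishes on the two. -/
def conjugateDirection (f : Plane → EuclideanSpace ℝ (Fin 4)) (q : Plane × ℝ) : Plane :=
  (-(normalForm f 1 0 q.1 + q.2 * normalForm f 1 1 q.1)) • EuclideanSpace.single 0 1
    + (normalForm f 0 0 q.1 + q.2 * normalForm f 0 1 q.1) • EuclideanSpace.single 1 1

@[simp]
theorem conjugateDirection_zero (f : Plane → EuclideanSpace ℝ (Fin 4)) (q : Plane × ℝ) :
    conjugateDirection f q 0 = -(normalForm f 1 0 q.1 + q.2 * normalForm f 1 1 q.1) := by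
  simp [conjugateDirection]

@[simp]
theorem conjugateDirection_one (f : Plane → EuclideanSpace ℝ (Fin 4)) (q : Plane × ℝ) :
    conjugateDirection f q 1 = normalForm f 0 0 q.1 + q.2 * normalForm f 0 1 q.1 := by
  simp [conjugateDirection]

/-- The tangent vector `∂₀f + τ ∂₁f`, for `q = (u, τ)`. -/
def slopeVector (f : Plane → EuclideanSpace ℝ (Fin 4)) (q : Plane × ℝ) :
    EuclideanSpace ℝ (Fin 4) :=
  pd 0 f q.1 + q.2 • pd 1 f q.1

/-- A tangent vector orthogonal to `slopeVector`. -/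
def slopeNormal (f : Plane → EuclideanSpace ℝ (Fin 4)) (q : Plane × ℝ) :
    EuclideanSpace ℝ (Fin 4) :=
  inner ℝ (slopeVector f q) (slopeVector f q) • pd 1 f q.1
    - inner ℝ (pd 1 f q.1) (slopeVector f q) • slopeVector f q

/-- The derivative of `∂₀f + τ ∂₁f` along `conjugateDirection`, for `τ` held constant. -/
def slopeDrift (f : Plane → EuclideanSpace ℝ (Fin 4)) (q : Plane × ℝ) :
    EuclideanSpace ℝ (Fin 4) :=
  conjugateDirection f q 0 • (pd 0 (pd 0 f) q.1 + q.2 • pd 0 (pd 1 f) q.1)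
    + conjugateDirection f q 1 • (pd 1 (pd 0 f) q.1 + q.2 • pd 1 (pd 1 f) q.1)

/-- The right-hand side of the equation for the slope `τ` which says that the derivative of
`∂₀f + τ ∂₁f` along `conjugateDirection` has no component along `slopeNormal`. -/
def slopeRate (f : Plane → EuclideanSpace ℝ (Fin 4)) (q : Plane × ℝ) : ℝ :=
  -inner ℝ (slopeDrift f q) (slopeNormal f q) / inner ℝ (pd 1 f q.1) (slopeNormal f q)

section Smooth

variable {f : Plane → EuclideanSpace ℝ (Fin 4)} {V : Set Plane}

theorem contDiffOn_comp_fst {F : Type*} [NormedAddCommGroup F] [NormedSpace ℝ F]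
    {G : Plane → F} (hG : ContDiffOn ℝ ∞ G V) :
    ContDiffOn ℝ ∞ (fun q : Plane × ℝ => G q.1) (V ×ˢ univ) :=
  hG.comp contDiffOn_fst fun _ hq => hq.1

theorem contDiffOn_conjugateDirection (hf : IsSphericalImmersionOn f V) :
    ContDiffOn ℝ ∞ (conjugateDirection f) (V ×ˢ univ) := by
  have h := fun i j => contDiffOn_comp_fst (hf.contDiffOn_normalForm i j)
  have hs : ContDiffOn ℝ ∞ (fun q : Plane × ℝ => q.2) (V ×ˢ univ) := contDiffOn_snd
  exact (((h 1 0).add (hs.mul (h 1 1))).neg.smul contDiffOn_const).add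
    (((h 0 0).add (hs.mul (h 0 1))).smul contDiffOn_const)

theorem contDiffOn_slopeVector (hf : IsSphericalImmersionOn f V) :
    ContDiffOn ℝ ∞ (slopeVector f) (V ×ˢ univ) := by
  have h := fun i => contDiffOn_comp_fst (contDiffOn_pd hf.isOpen hf.contDiffOn i)
  exact (h 0).add (contDiffOn_snd.smul (h 1))

theorem contDiffOn_slopeNormal (hf : IsSphericalImmersionOn f V) :
    ContDiffOn ℝ ∞ (slopeNormal f) (V ×ˢ univ) := by
  have h := contDiffOn_comp_fst (contDiffOn_pd hf.isOpen hf.contDiffOn 1)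
  have hζ := contDiffOn_slopeVector hf
  exact ((hζ.inner ℝ hζ).smul h).sub ((h.inner ℝ hζ).smul hζ)

theorem inner_pd_slopeNormal_pos (hf : IsSphericalImmersionOn f V) {q : Plane × ℝ}
    (hq : q.1 ∈ V) : 0 < inner ℝ (pd 1 f q.1) (slopeNormal f q) := by
  have := gram_pos (hf.linearIndependent q.1 hq)
  refine this.trans_eq ?_
  simp only [slopeNormal, slopeVector, inner_sub_right, inner_add_left, inner_add_right,
    real_inner_smul_left, real_inner_smul_right, real_inner_comm (pd 0 f q.1) (pd 1 f q.1)]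
  ring

theorem contDiffOn_slopeRate (hf : IsSphericalImmersionOn f V) :
    ContDiffOn ℝ ∞ (slopeRate f) (V ×ˢ univ) := by
  have h := fun i j => contDiffOn_comp_fst
    (contDiffOn_pd hf.isOpen (contDiffOn_pd hf.isOpen hf.contDiffOn j) i)
  have ha : ∀ i : Fin 2, ContDiffOn ℝ ∞ (fun q => conjugateDirection f q i) (V ×ˢ univ) :=
    fun i => (contDiffOn_euclidean.1 (contDiffOn_conjugateDirection hf)) i
  have hs : ContDiffOn ℝ ∞ (fun q : Plane × ℝ => q.2) (V ×ˢ univ) := contDiffOn_snd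
  have hdrift : ContDiffOn ℝ ∞ (slopeDrift f) (V ×ˢ univ) :=
    ((ha 0).smul ((h 0 0).add (hs.smul (h 0 1)))).add
      ((ha 1).smul ((h 1 0).add (hs.smul (h 1 1))))
  have hP := contDiffOn_slopeNormal hf
  exact (hdrift.inner ℝ hP).neg.div
    ((contDiffOn_comp_fst (contDiffOn_pd hf.isOpen hf.contDiffOn 1)).inner ℝ hP)
    fun q hq => (inner_pd_slopeNormal_pos hf hq.1).ne'

end Smooth

/-! ### The conjugate fields -/

section Conjugate

variable {f : Plane → EuclideanSpace ℝ (Fin 4)} {V : Set Plane}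

/-- At a point where the second fundamental form is not a multiple of the metric there is a slope
`τ` such that `∂₀ + τ ∂₁` is neither parallel nor orthogonal to its conjugate direction: each
condition is the nonvanishing of a quadratic polynomial in `τ`. -/
theorem exists_slope (hf : IsSphericalImmersionOn f V) {p : Plane} (hp : p ∈ V)
    (hnu : ¬∃ r : ℝ, ∀ i j, normalForm f i j p = r * inner ℝ (pd i f p) (pd j f p)) :
    ∃ τ : ℝ,
      conjugateDirection f (p, τ) 1 - τ * conjugateDirection f (p, τ) 0 ≠ 0 ∧
      inner ℝ (fderiv ℝ f p (conjugateDirection f (p, τ))) (slopeVector f (p, τ)) ≠ 0 := by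
  have hsymm := hf.normalForm_comm hp
  have hG00 : inner ℝ (pd 0 f p) (pd 0 f p) ≠ (0 : ℝ) :=
    inner_self_ne_zero.2 ((hf.linearIndependent p hp).ne_zero 0)
  have hG10 := real_inner_comm (pd 0 f p) (pd 1 f p)
  set G00 := inner ℝ (pd 0 f p) (pd 0 f p) with hG00d
  set G01 := inner ℝ (pd 0 f p) (pd 1 f p) with hG01d
  set G11 := inner ℝ (pd 1 f p) (pd 1 f p) with hG11d
  set h00 := normalForm f 0 0 p with h00d
  set h01 := normalForm f 0 1 p with h01d
  set h11 := normalForm f 1 1 p with h11d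
  have hq : ¬(h00 * G01 - h01 * G00 = 0 ∧ h00 * G11 - h11 * G00 = 0 ∧
      h01 * G11 - h11 * G01 = 0) := by
    rintro ⟨e0, e1, -⟩
    refine hnu ⟨h00 / G00, fun i j => ?_⟩
    fin_cases i <;> fin_cases j <;> simp only [Fin.zero_eta, Fin.mk_one]
    · rw [← h00d, ← hG00d]; field_simp
    · rw [← h01d, ← hG01d]; field_simp; linarith
    · rw [hsymm, hG10]; field_simp; linarith
    · rw [← h11d, ← hG11d]; field_simp; linarith
  have hr : ¬(h00 = 0 ∧ 2 * h01 = 0 ∧ h11 = 0) := by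
    rintro ⟨e0, e1, e2⟩
    have e1' : h01 = 0 := by linarith
    exact hq (by simp [e0, e1', e2])
  obtain ⟨τ, h1, h2⟩ := exists_quadratics_ne_zero hr hq
  refine ⟨τ, ?_, ?_⟩
  · convert! h1 using 1
    simp only [conjugateDirection_one, conjugateDirection_zero, hsymm]
    rw [← h00d, ← h01d, ← h11d]
    ring
  · convert! h2 using 1
    rw [fderiv_eq_sum_pd]
    simp only [conjugateDirection_one, conjugateDirection_zero, hsymm, slopeVector,
      inner_add_left, inner_add_right, real_inner_smul_left, real_inner_smul_right, hG10]
    rw [← h00d, ← h01d, ← h11d, ← hG00d, ← hG01d, ← hG11d]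
    ring

theorem slopeVector_ne_zero (hf : IsSphericalImmersionOn f V) {q : Plane × ℝ} (hq : q.1 ∈ V) :
    slopeVector f q ≠ 0 := by
  intro h
  have := LinearIndependent.pair_iff.1 (hf.linearIndependent q.1 hq) 1 q.2
    (by rw [one_smul]; exact h)
  exact one_ne_zero this.1

/-- A vector is a multiple of `f` if it is orthogonal to the tangent vectors `slopeVector` and
`slopeNormal` and to the normal of the surface. It will be applied to the derivative of a unit
multiple of `∂₀f + τ ∂₁f`. -/
theorem eq_neg_smul_of_inner_eq (hf : IsSphericalImmersionOn f V) {u : Plane} (hu : u ∈ V) {τ : ℝ}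
    {v : EuclideanSpace ℝ (Fin 4)} {r : ℝ}
    (hx : inner ℝ v (f u) = -r)
    (hζ : inner ℝ v (slopeVector f (u, τ)) = 0)
    (hP : inner ℝ v (slopeNormal f (u, τ)) = 0)
    (hdet : det4 v (f u) (pd 0 f u) (pd 1 f u) = 0) : v = -r • f u := by
  have h0 := hf.inner_pd hu 0
  have h1 := hf.inner_pd hu 1
  have hζζ : inner ℝ (slopeVector f (u, τ)) (slopeVector f (u, τ)) ≠ (0 : ℝ) :=
    inner_self_ne_zero.2 (slopeVector_ne_zero hf hu)
  have hv1 : inner ℝ v (pd 1 f u) = 0 := by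
    have hP' := hP
    simp only [slopeNormal, inner_sub_right, real_inner_smul_right, hζ, mul_zero, sub_zero] at hP'
    exact (mul_eq_zero.1 hP').resolve_left hζζ
  have hv0 : inner ℝ v (pd 0 f u) = 0 := by
    simpa [slopeVector, inner_add_right, real_inner_smul_right, hv1] using hζ
  have : v + r • f u = 0 := by
    refine eq_zero_of_det4_eq_zero (hf.linearIndependent u hu) (hf.ne_zero hu) h0 h1 ?_ ?_ ?_ ?_
    · rw [inner_add_left, real_inner_smul_left, hf.inner_self u hu, hx]; ring
    · rw [inner_add_left, real_inner_smul_left, h0, hv0]; ring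
    · rw [inner_add_left, real_inner_smul_left, h1, hv1]; ring
    · rw [det4_add, det4_smul, hdet, det4_self_left]; ring
  rw [neg_smul]
  exact eq_neg_of_add_eq_zero_left this

/-- Near a point where the second fundamental form is not a multiple of the metric, there are
fields `X, Y` such that the unit field `η = df(Y)` satisfies `dη(X) = -⟪df(X), η⟫ f`. Here `Y` is
the normalization of `∂₀ + τ ∂₁`, where `τ` solves the equation `dτ(X) = slopeRate`. -/
theorem exists_conjugate_fields (hf : IsSphericalImmersionOn f V) {p : Plane} (hp : p ∈ V)
    (hnu : ¬∃ r : ℝ, ∀ i j, normalForm f i j p = r * inner ℝ (pd i f p) (pd j f p)) :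
    ∃ (W : Set Plane) (X Y : Plane → Plane), IsOpen W ∧ p ∈ W ∧ W ⊆ V ∧
      ContDiffOn ℝ ∞ X W ∧ ContDiffOn ℝ ∞ Y W ∧ ∀ u ∈ W,
        LinearIndependent ℝ ![X u, Y u] ∧
        inner ℝ (fderiv ℝ f u (Y u)) (fderiv ℝ f u (Y u)) = (1 : ℝ) ∧
        inner ℝ (fderiv ℝ f u (X u)) (fderiv ℝ f u (Y u)) ≠ (0 : ℝ) ∧
        fderiv ℝ (fun w => fderiv ℝ f w (Y w)) u (X u) =
          -inner ℝ (fderiv ℝ f u (X u)) (fderiv ℝ f u (Y u)) • f u := by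
  obtain ⟨τ₀, hτ₀, hτ₀'⟩ := exists_slope hf hp hnu
  have hO : IsOpen (V ×ˢ (univ : Set ℝ)) := hf.isOpen.prod isOpen_univ
  have hX := contDiffOn_conjugateDirection hf
  have hXi : ∀ i : Fin 2, ContDiffOn ℝ ∞ (fun q => conjugateDirection f q i) (V ×ˢ univ) :=
    fun i => (contDiffOn_euclidean.1 hX) i
  have hs : ContDiffOn ℝ ∞ (fun q : Plane × ℝ => q.2) (V ×ˢ univ) := contDiffOn_snd
  -- the slopes at which both open conditions of `exists_slope` hold
  let ρ : Plane × ℝ → ℝ := fun q =>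
    (conjugateDirection f q 1 - q.2 * conjugateDirection f q 0) *
      inner ℝ (fderiv ℝ f q.1 (conjugateDirection f q)) (slopeVector f q)
  have hρ : ContDiffOn ℝ ∞ ρ (V ×ˢ univ) := by
    refine ((hXi 1).sub (hs.mul (hXi 0))).mul (ContDiffOn.inner ℝ ?_ (contDiffOn_slopeVector hf))
    exact (contDiffOn_comp_fst (hf.contDiffOn.fderiv_of_isOpen hf.isOpen (by simp))).clm_apply hX
  have hΩ := hρ.continuousOn.isOpen_inter_preimage hO (isOpen_compl_singleton (x := (0 : ℝ)))
  set Ω := (V ×ˢ (univ : Set ℝ)) ∩ ρ ⁻¹' {0}ᶜ with hΩd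
  have hΩsub : Ω ⊆ V ×ˢ univ := inter_subset_left
  have hpΩ : (p, τ₀) ∈ Ω := ⟨⟨hp, mem_univ _⟩, mul_ne_zero hτ₀ hτ₀'⟩
  have hne : conjugateDirection f (p, τ₀) ≠ 0 := fun h => hτ₀ (by simp [h])
  obtain ⟨W, τ, hW, hpW, hτ, -, hsol⟩ := exists_quasilinear_solution hΩ (hX.mono hΩsub)
    ((contDiffOn_slopeRate hf).mono hΩsub) hpΩ hne
  have hWV : W ⊆ V := fun u hu => (hΩsub (hsol u hu).1).1
  have hpair : ContDiffOn ℝ ∞ (fun u => (u, τ u)) W := contDiffOn_id.prodMk hτ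
  have hmaps : MapsTo (fun u => (u, τ u)) W (V ×ˢ univ) := fun u hu => hΩsub (hsol u hu).1
  let ζ : Plane → EuclideanSpace ℝ (Fin 4) := fun u => slopeVector f (u, τ u)
  have hζ : ContDiffOn ℝ ∞ ζ W := (contDiffOn_slopeVector hf).comp hpair hmaps
  have hζ0 : ∀ u ∈ W, ζ u ≠ 0 := fun u hu => slopeVector_ne_zero hf (hWV hu)
  let n : Plane → ℝ := fun u => ‖ζ u‖⁻¹
  have hn : ContDiffOn ℝ ∞ n W := (hζ.norm ℝ hζ0).inv fun u hu => norm_ne_zero_iff.2 (hζ0 u hu)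
  have hn0 : ∀ u ∈ W, n u ≠ 0 := fun u hu => inv_ne_zero (norm_ne_zero_iff.2 (hζ0 u hu))
  let Y : Plane → Plane := fun u =>
    n u • (EuclideanSpace.single 0 1 + τ u • EuclideanSpace.single 1 1)
  have hYf : ∀ u, fderiv ℝ f u (Y u) = n u • ζ u := fun u => by
    simp only [Y, map_smul, map_add]; rfl
  have hfun : (fun w => fderiv ℝ f w (Y w)) = fun w => n w • ζ w := funext hYf
  refine ⟨W, fun u => conjugateDirection f (u, τ u), Y, hW, hpW, hWV, hX.comp hpair hmaps,
    hn.smul (contDiffOn_const.add (hτ.smul contDiffOn_const)), fun u hu => ?_⟩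
  have hu' := hWV hu
  obtain ⟨hΩu, hpde⟩ := hsol u hu
  obtain ⟨hr, hq⟩ := mul_ne_zero_iff.1 (show ρ (u, τ u) ≠ 0 from hΩu.2)
  have hηη : ∀ w ∈ W, inner ℝ (n w • ζ w) (n w • ζ w) = (1 : ℝ) := fun w hw => by
    have := norm_ne_zero_iff.2 (hζ0 w hw)
    rw [real_inner_smul_left, real_inner_smul_right, real_inner_self_eq_norm_sq]
    simp only [n]
    field_simp
  rw [hfun, hYf u]
  set x := conjugateDirection f (u, τ u) with hxd
  refine ⟨?_, hηη u hu, ?_, ?_⟩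
  · rw [LinearIndependent.pair_iff]
    intro s t hst
    have e0 : s * x 0 + t * n u = 0 := by
      simpa [Y, hxd] using congrArg (fun w : Plane => w 0) hst
    have e1 : s * x 1 + t * (n u * τ u) = 0 := by
      simpa [Y, hxd] using congrArg (fun w : Plane => w 1) hst
    have hs0 : s = 0 := by
      refine (mul_eq_zero.1 (?_ : s * (x 1 - τ u * x 0) = 0)).resolve_right hr
      linear_combination e1 - τ u * e0
    refine ⟨hs0, ?_⟩
    rw [hs0, zero_mul, zero_add] at e0
    exact (mul_eq_zero.1 e0).resolve_right (hn0 u hu)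
  · rw [real_inner_smul_right]
    exact mul_ne_zero (hn0 u hu) hq
  -- the derivatives of `ζ` and of `η = n ζ` along `x`
  have hWn := hW.mem_nhds hu
  have hpd : ∀ j, HasFDerivAt (pd j f) (fderiv ℝ (pd j f) u) u := fun j =>
    (((contDiffOn_pd hf.isOpen hf.contDiffOn j).contDiffAt
      (hf.isOpen.mem_nhds hu')).differentiableAt (by simp)).hasFDerivAt
  have hτd : HasFDerivAt τ (fderiv ℝ τ u) u :=
    ((hτ.contDiffAt hWn).differentiableAt (by simp)).hasFDerivAt
  have hnd : HasFDerivAt n (fderiv ℝ n u) u :=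
    ((hn.contDiffAt hWn).differentiableAt (by simp)).hasFDerivAt
  have hζd : HasFDerivAt ζ (fderiv ℝ ζ u) u :=
    ((hζ.contDiffAt hWn).differentiableAt (by simp)).hasFDerivAt
  have hζx : fderiv ℝ ζ u x = slopeDrift f (u, τ u) + slopeRate f (u, τ u) • pd 1 f u := by
    have h1 := (hpd 0).add (hτd.smul (hpd 1))
    have h2 := congrArg (fun A => A x) (hζd.unique h1)
    simp only [add_apply, smul_apply,
      ContinuousLinearMap.smulRight_apply, hpde] at h2
    rw [h2, fderiv_eq_sum_pd (pd 0 f), fderiv_eq_sum_pd (pd 1 f), slopeDrift, ← hxd]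
    module
  have hηd : HasFDerivAt (fun w => n w • ζ w) (fderiv ℝ (fun w => n w • ζ w) u) u :=
    (((hn.smul hζ).contDiffAt hWn).differentiableAt (by simp)).hasFDerivAt
  have hηx : fderiv ℝ (fun w => n w • ζ w) u x =
      n u • fderiv ℝ ζ u x + fderiv ℝ n u x • ζ u := by
    have h2 := congrArg (fun A => A x) (hηd.unique (hnd.smul hζd))
    simpa using h2
  set v := fderiv ℝ (fun w => n w • ζ w) u x with hv
  have hζP : inner ℝ (ζ u) (slopeNormal f (u, τ u)) = 0 := by
    simp only [slopeNormal, inner_sub_right, real_inner_smul_right]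
    rw [real_inner_comm (slopeVector f (u, τ u)) (pd 1 f u)]
    simp only [ζ]
    ring
  refine eq_neg_smul_of_inner_eq hf hu' (τ := τ u) ?_ ?_ ?_ ?_
  · -- differentiate `⟪η, f⟫ = 0`
    have h1 := hηd.inner ℝ (hf.differentiableAt hu').hasFDerivAt
    have h2 : (fun w => inner ℝ (n w • ζ w) (f w)) =ᶠ[𝓝 u] fun _ => (0 : ℝ) := by
      filter_upwards [hWn] with w hw
      rw [← hYf w, real_inner_comm, hf.inner_fderiv (hWV hw)]
    have h3 := congrArg (fun A => A x)
      (h1.unique ((hasFDerivAt_const (0 : ℝ) u).congr_of_eventuallyEq h2))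
    have h4 : inner ℝ (n u • ζ u) (fderiv ℝ f u x) + inner ℝ v (f u) = 0 := by
      simpa using h3
    rw [real_inner_comm (n u • ζ u)]
    linarith
  · -- differentiate `⟪η, η⟫ = 1`
    have h1 := hηd.inner ℝ hηd
    have h2 : (fun w => inner ℝ (n w • ζ w) (n w • ζ w)) =ᶠ[𝓝 u] fun _ => (1 : ℝ) := by
      filter_upwards [hWn] with w hw using hηη w hw
    have h3 := congrArg (fun A => A x)
      (h1.unique ((hasFDerivAt_const (1 : ℝ) u).congr_of_eventuallyEq h2))
    have h4 : inner ℝ (n u • ζ u) v + inner ℝ v (n u • ζ u) = 0 := by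
      simpa using h3
    rw [real_inner_comm v (n u • ζ u)] at h4
    have h5 : n u * inner ℝ v (ζ u) = 0 := by
      rw [← real_inner_smul_right]; linarith
    exact (mul_eq_zero.1 h5).resolve_left (hn0 u hu)
  · -- this is the equation solved by `τ`
    have hD := (inner_pd_slopeNormal_pos hf (q := (u, τ u)) hu').ne'
    rw [hηx, inner_add_left, real_inner_smul_left, real_inner_smul_left, hζP, hζx, inner_add_left,
      real_inner_smul_left, slopeRate, div_mul_cancel₀ _ hD]
    ring
  · -- `x` is conjugate to `∂₀ + τ ∂₁`
    rw [hηx, hζx]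
    simp only [slopeDrift, det4_add, det4_smul, ζ, slopeVector, det4_self_middle, det4_self_right,
      conjugateDirection_zero, conjugateDirection_one]
    simp only [normalForm]
    ring

end Conjugate

/-! ### The Levi-Civita connection and the second fundamental form of an immersed plane domain -/

/-- The matrix of the metric induced by `f`. -/
def gram (f : Plane → EuclideanSpace ℝ (Fin 4)) (u : Plane) : Matrix (Fin 2) (Fin 2) ℝ :=
  Matrix.of fun i j => inner ℝ (pd i f u) (pd j f u)

/-- The coefficients of the second fundamental form of `f` in the sphere. -/
def formCoeff (f : Plane → EuclideanSpace ℝ (Fin 4)) (u : Plane) (i j : Fin 2) :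
    EuclideanSpace ℝ (Fin 4) :=
  pd i (pd j f) u - ∑ k, christoffel (gram f) k i j u • pd k f u + gram f u i j • f u

theorem pd_inner {F : Type*} [NormedAddCommGroup F] [InnerProductSpace ℝ F] {a b : Plane → F}
    {u : Plane} (ha : DifferentiableAt ℝ a u) (hb : DifferentiableAt ℝ b u) (i : Fin 2) :
    pd i (fun w => inner ℝ (a w) (b w)) u = inner ℝ (pd i a u) (b u) + inner ℝ (a u) (pd i b u) := by
  refine (congrArg (fun A => A (EuclideanSpace.single i (1 : ℝ)))
    (ha.hasFDerivAt.inner ℝ hb.hasFDerivAt).fderiv).trans ?_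
  simp [pd, add_comm]

theorem det4_formCoeff (f : Plane → EuclideanSpace ℝ (Fin 4)) (u : Plane) (i j : Fin 2) :
    det4 (formCoeff f u i j) (f u) (pd 0 f u) (pd 1 f u) = normalForm f i j u := by
  rw [formCoeff, Fin.sum_univ_two, sub_eq_add_neg, ← neg_one_smul ℝ]
  simp only [det4_add, det4_smul, det4_self_left, det4_self_middle, det4_self_right]
  rw [normalForm]
  ring

namespace IsSphericalImmersionOn

variable {f : Plane → EuclideanSpace ℝ (Fin 4)} {V : Set Plane} {u : Plane}

theorem differentiableAt_pd (hf : IsSphericalImmersionOn f V) (hu : u ∈ V) (i : Fin 2) :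
    DifferentiableAt ℝ (pd i f) u :=
  ((contDiffOn_pd hf.isOpen hf.contDiffOn i).contDiffAt
    (hf.isOpen.mem_nhds hu)).differentiableAt (by simp)

theorem det_gram_pos (hf : IsSphericalImmersionOn f V) (hu : u ∈ V) : 0 < (gram f u).det := by
  rw [Matrix.det_fin_two]
  refine (gram_pos (hf.linearIndependent u hu)).trans_eq ?_
  simp only [gram, Matrix.of_apply, real_inner_comm (pd 0 f u) (pd 1 f u)]

/-- The Christoffel symbols give the tangential part of the second derivatives. -/
theorem sum_christoffel_mul_inner (hf : IsSphericalImmersionOn f V) (hu : u ∈ V)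
    (i j l : Fin 2) :
    ∑ k, christoffel (gram f) k i j u * inner ℝ (pd k f u) (pd l f u) =
      inner ℝ (pd i (pd j f) u) (pd l f u) := by
  have hmul := Matrix.mul_nonsing_inv (gram f u) (hf.det_gram_pos hu).ne'.isUnit
  have hmul' : ∀ l m, ∑ k, inner ℝ (pd k f u) (pd l f u) * (gram f u)⁻¹ k m =
      (1 : Matrix (Fin 2) (Fin 2) ℝ) l m := fun l m => by
    rw [← hmul, Matrix.mul_apply]
    exact Finset.sum_congr rfl fun k _ => by rw [real_inner_comm]; rfl
  have hd : ∀ i j m, pd i (fun w => gram f w j m) u =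
      inner ℝ (pd i (pd j f) u) (pd m f u) + inner ℝ (pd i (pd m f) u) (pd j f u) := by
    intro i j m
    rw [real_inner_comm (pd j f u)]
    exact pd_inner (hf.differentiableAt_pd hu j) (hf.differentiableAt_pd hu m) i
  have hcomm := pd_pd_comm (hf.contDiffOn.contDiffAt (hf.isOpen.mem_nhds hu))
  have hT : ∀ m, pd i (fun w => gram f w j m) u + pd j (fun w => gram f w i m) u
      - pd m (fun w => gram f w i j) u = 2 * inner ℝ (pd i (pd j f) u) (pd m f u) := by
    intro m
    rw [hd, hd, hd, hcomm j i, hcomm m i, hcomm m j]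
    ring
  simp only [christoffel, hT]
  simp only [Fin.sum_univ_two] at hmul' ⊢
  have h0 := hmul' l 0
  have h1 := hmul' l 1
  obtain rfl | rfl : l = 0 ∨ l = 1 := by lia
  all_goals
    simp only [Matrix.one_apply, if_true, zero_ne_one, one_ne_zero, if_false] at h0 h1
    linear_combination (inner ℝ (pd i (pd j f) u) (pd 0 f u)) * h0 +
      (inner ℝ (pd i (pd j f) u) (pd 1 f u)) * h1

theorem inner_formCoeff_pd (hf : IsSphericalImmersionOn f V) (hu : u ∈ V) (i j l : Fin 2) :
    inner ℝ (formCoeff f u i j) (pd l f u) = 0 := by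
  rw [formCoeff, inner_add_left, inner_sub_left, sum_inner]
  simp only [real_inner_smul_left, hf.sum_christoffel_mul_inner hu, hf.inner_pd hu]
  ring

theorem inner_formCoeff_self (hf : IsSphericalImmersionOn f V) (hu : u ∈ V) (i j : Fin 2) :
    inner ℝ (formCoeff f u i j) (f u) = 0 := by
  have h1 := pd_inner (hf.differentiableAt hu) (hf.differentiableAt_pd hu j) i
  have h2 : (fun w => inner ℝ (f w) (pd j f w)) =ᶠ[𝓝 u] fun _ => (0 : ℝ) := by
    filter_upwards [hf.isOpen.mem_nhds hu] with w hw using hf.inner_pd hw j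
  have h3 : pd i (fun w => inner ℝ (f w) (pd j f w)) u = 0 := by
    rw [pd, h2.fderiv_eq]; simp
  rw [h3, real_inner_comm (pd i (pd j f) u)] at h1
  rw [formCoeff, inner_add_left, inner_sub_left, sum_inner]
  simp only [real_inner_smul_left, fun k => real_inner_comm (f u) (pd k f u), hf.inner_pd hu,
    hf.inner_self u hu, gram, Matrix.of_apply]
  simp
  linarith

/-- If `normalForm` is a multiple of the metric, so is the second fundamental form. -/
theorem exists_formCoeff_eq_smul (hf : IsSphericalImmersionOn f V) (hu : u ∈ V) {r : ℝ}
    (hr : ∀ i j, normalForm f i j u = r * inner ℝ (pd i f u) (pd j f u)) :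
    ∃ ζ : EuclideanSpace ℝ (Fin 4), ∀ i j, formCoeff f u i j = gram f u i j • ζ := by
  have hG00 : inner ℝ (pd 0 f u) (pd 0 f u) ≠ (0 : ℝ) :=
    inner_self_ne_zero.2 ((hf.linearIndependent u hu).ne_zero 0)
  refine ⟨(inner ℝ (pd 0 f u) (pd 0 f u) : ℝ)⁻¹ • formCoeff f u 0 0, fun i j => ?_⟩
  rw [← sub_eq_zero]
  refine eq_zero_of_det4_eq_zero (hf.linearIndependent u hu) (hf.ne_zero hu) (hf.inner_pd hu 0)
    (hf.inner_pd hu 1) ?_ ?_ ?_ ?_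
  · simp [inner_sub_left, real_inner_smul_left, hf.inner_formCoeff_self hu]
  · simp [inner_sub_left, real_inner_smul_left, hf.inner_formCoeff_pd hu]
  · simp [inner_sub_left, real_inner_smul_left, hf.inner_formCoeff_pd hu]
  · rw [sub_eq_add_neg, ← neg_one_smul ℝ]
    simp only [det4_add, det4_smul, det4_formCoeff, hr, gram, Matrix.of_apply]
    field_simp
    ring

theorem fderiv_injective (hf : IsSphericalImmersionOn f V) (hu : u ∈ V) :
    Function.Injective (fderiv ℝ f u) := by
  rw [injective_iff_map_eq_zero]
  intro v hv
  rw [fderiv_eq_sum_pd] at hv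
  have := LinearIndependent.pair_iff.1 (hf.linearIndependent u hu) _ _ hv
  ext i
  fin_cases i
  exacts [this.1, this.2]

/-- Gauss formula for the derivative of `df(Y)` in the direction `v`: its tangential part is the
covariant derivative, its normal part in the sphere is the second fundamental form. -/
theorem fderiv_fderiv_apply (hf : IsSphericalImmersionOn f V) (hu : u ∈ V) {Y : Plane → Plane}
    (hY : DifferentiableAt ℝ Y u) (v : Plane) :
    fderiv ℝ (fun w => fderiv ℝ f w (Y w)) u v =
      fderiv ℝ f u (WithLp.toLp 2 fun k => ∑ i, v i * (pd i (fun w => Y w k) u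
        + ∑ j, christoffel (gram f) k i j u * Y u j))
      + ∑ i, ∑ j, (v i * Y u j) • formCoeff f u i j
      - (inner ℝ (fderiv ℝ f u v) (fderiv ℝ f u (Y u)) : ℝ) • f u := by
  have hYk : ∀ k : Fin 2, DifferentiableAt ℝ (fun w => Y w k) u := fun k =>
    differentiableAt_euclidean.1 hY k
  have hfun : (fun w => fderiv ℝ f w (Y w)) = fun w => Y w 0 • pd 0 f w + Y w 1 • pd 1 f w :=
    funext fun w => fderiv_eq_sum_pd f w (Y w)
  have h1 := (((hYk 0).hasFDerivAt.smul (hf.differentiableAt_pd hu 0).hasFDerivAt).add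
    ((hYk 1).hasFDerivAt.smul (hf.differentiableAt_pd hu 1).hasFDerivAt)).fderiv
  have h2 := congrArg (fun A => A v) h1
  have h3 : fderiv ℝ (fun w => Y w 0 • pd 0 f w + Y w 1 • pd 1 f w) u v = _ := h2
  rw [hfun, h3]
  simp only [add_apply, smul_apply, ContinuousLinearMap.smulRight_apply]
  rw [fderiv_eq_sum_pd (pd 0 f), fderiv_eq_sum_pd (pd 1 f), fderiv_eq_sum_pd (fun w => Y w 0),
    fderiv_eq_sum_pd (fun w => Y w 1)]
  rw [fderiv_eq_sum_pd f u, fderiv_eq_sum_pd f u v, fderiv_eq_sum_pd f u (Y u)]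
  simp only [Fin.sum_univ_two, formCoeff, gram, Matrix.of_apply, inner_add_left, inner_add_right,
    real_inner_smul_left, real_inner_smul_right, smul_eq_mul]
  module

/-- If the derivative of `df(Y)` in the direction `v` is a multiple of `f`, then the covariant
derivative `∇_v Y` and the second fundamental form `α(v, Y)` vanish. -/
theorem eq_zero_of_fderiv_fderiv_apply (hf : IsSphericalImmersionOn f V) (hu : u ∈ V)
    {Y : Plane → Plane} (hY : DifferentiableAt ℝ Y u) (v : Plane)
    (h : fderiv ℝ (fun w => fderiv ℝ f w (Y w)) u v =
      -(inner ℝ (fderiv ℝ f u v) (fderiv ℝ f u (Y u)) : ℝ) • f u) :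
    (WithLp.toLp 2 fun k => ∑ i, v i * (pd i (fun w => Y w k) u
        + ∑ j, christoffel (gram f) k i j u * Y u j) : Plane) = 0 ∧
      ∑ i, ∑ j, (v i * Y u j) • formCoeff f u i j = 0 := by
  rw [hf.fderiv_fderiv_apply hu hY, sub_eq_add_neg, ← neg_smul, add_eq_right] at h
  set C : Plane := WithLp.toLp 2 fun k => ∑ i, v i * (pd i (fun w => Y w k) u
        + ∑ j, christoffel (gram f) k i j u * Y u j)
  have horth : ∀ w : Plane, inner ℝ (∑ i, ∑ j, (v i * Y u j) • formCoeff f u i j)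
      (fderiv ℝ f u w) = 0 := by
    intro w
    rw [fderiv_eq_sum_pd]
    simp only [sum_inner, inner_add_right, real_inner_smul_left, real_inner_smul_right,
      hf.inner_formCoeff_pd hu, mul_zero, add_zero, Finset.sum_const_zero]
  have hC : fderiv ℝ f u C = 0 := by
    have h1 := congrArg (fun z => inner ℝ z (fderiv ℝ f u C)) h
    simp only [inner_add_left, horth, add_zero, inner_zero_left] at h1
    exact inner_self_eq_zero.1 h1
  rw [hC, zero_add] at h
  exact ⟨hf.fderiv_injective hu (by rw [hC, map_zero]), h⟩

end IsSphericalImmersionOn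

/-! ### Surfaces in charts -/

section Charts

variable {L : Type*} [TopologicalSpace L] [ChartedSpace (EuclideanSpace ℝ (Fin 2)) L]
  {g : L → UnitSphere 3}

theorem IsSurface.contMDiff_position (hg : IsSurface g) :
    ContMDiff (𝓡 2) 𝓘(ℝ, EuclideanSpace ℝ (Fin 4)) ∞ (position g) := by
  have : Fact (Module.finrank ℝ (EuclideanSpace ℝ (Fin (3 + 1))) = 3 + 1) :=
    ⟨finrank_euclideanSpace_fin⟩
  exact contMDiff_coe_sphere.comp hg.contMDiff

theorem IsSurface.pushforward_injective (hg : IsSurface g) (x : L) :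
    Function.Injective (pushforward g x) := by
  have : Fact (Module.finrank ℝ (EuclideanSpace ℝ (Fin (3 + 1))) = 3 + 1) :=
    ⟨finrank_euclideanSpace_fin⟩
  have h1 : MDifferentiableAt (𝓡 2) (𝓡 3) g x :=
    (hg.contMDiff x).mdifferentiableAt (by simp)
  have h2 : MDifferentiableAt (𝓡 3) 𝓘(ℝ, EuclideanSpace ℝ (Fin 4))
      ((↑) : UnitSphere 3 → EuclideanSpace ℝ (Fin 4)) (g x) :=
    (contMDiff_coe_sphere (m := 1) (g x)).mdifferentiableAt (by simp)
  have h3 := mfderiv_comp x h2 h1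
  intro v w hvw
  have key : ∀ v, pushforward g x v = mfderiv (𝓡 3) 𝓘(ℝ, EuclideanSpace ℝ (Fin 4))
      ((↑) : UnitSphere 3 → EuclideanSpace ℝ (Fin 4)) (g x) (mfderiv (𝓡 2) (𝓡 3) g x v) :=
    fun v => congrArg (fun A => A v) h3
  rw [key, key] at hvw
  exact hg.injective_mfderiv x (injective_mvfderiv_subtypeVal_sphere (g x) hvw)

theorem secondFormCoeff_eq_formCoeff (x : L) (i j : Fin 2) :
    secondFormCoeff g x i j = formCoeff (localPosition g x) (extChartAt (𝓡 2) x x) i j := by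
  have : position g x = localPosition g x (extChartAt (𝓡 2) x x) := by
    rw [localPosition, extChartAt_to_inv]
  rw [secondFormCoeff, formCoeff, ← this]
  rfl

variable [IsManifold (𝓡 2) ∞ L]

theorem IsSurface.contDiffOn_localPosition (hg : IsSurface g) (p : L) :
    ContDiffOn ℝ ∞ (localPosition g p) (extChartAt (𝓡 2) p).target :=
  contMDiffOn_iff_contDiffOn.1
    (hg.contMDiff_position.comp_contMDiffOn (contMDiffOn_extChartAt_symm p))

/-- The differential of the chart at `p`, as a map into the coordinate plane. -/
def chartDeriv (p y : L) : TangentSpace (𝓡 2) y →L[ℝ] Plane :=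
  mfderiv (𝓡 2) 𝓘(ℝ, Plane) (extChartAt (𝓡 2) p) y

theorem chartDeriv_isInvertible {p y : L} (hy : y ∈ (extChartAt (𝓡 2) p).source) :
    (chartDeriv p y).IsInvertible :=
  have : IsManifold (𝓡 2) 1 L := IsManifold.of_le (n := ∞) (by simp)
  isInvertible_mfderiv_extChartAt hy

theorem chartDeriv_self (x : L) (v : TangentSpace (𝓡 2) x) :
    chartDeriv x x v = (show Plane from v) := by
  have : IsManifold (𝓡 2) 1 L := IsManifold.of_le (n := ∞) (by simp)
  rw [chartDeriv, mfderiv_extChartAt_self]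
  rfl

/-- The differential of a function given in a chart, by the chain rule. -/
theorem mfderiv_comp_extChartAt {F : Type*} [NormedAddCommGroup F] [NormedSpace ℝ F]
    {p y : L} (hy : y ∈ (extChartAt (𝓡 2) p).source) {H : L → F} {h : Plane → F}
    (hh : DifferentiableAt ℝ h (extChartAt (𝓡 2) p y))
    (hH : H =ᶠ[𝓝 y] fun z => h (extChartAt (𝓡 2) p z)) (v : TangentSpace (𝓡 2) y) :
    mfderiv (𝓡 2) 𝓘(ℝ, F) H y v = fderiv ℝ h (extChartAt (𝓡 2) p y) (chartDeriv p y v) := by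
  have : IsManifold (𝓡 2) 1 L := IsManifold.of_le (n := ∞) (by simp)
  have h1 : MDifferentiableAt (𝓡 2) 𝓘(ℝ, Plane) (extChartAt (𝓡 2) p) y :=
    mdifferentiableAt_extChartAt (by simpa using hy)
  have h2 := mfderiv_comp (I'' := 𝓘(ℝ, F)) y hh.mdifferentiableAt h1
  rw [mfderiv_eq_fderiv] at h2
  rw [hH.mfderiv_eq]
  exact congrArg (fun A => A v) h2

theorem IsSurface.pushforward_eq (hg : IsSurface g) {p y : L}
    (hy : y ∈ (extChartAt (𝓡 2) p).source) (v : TangentSpace (𝓡 2) y) :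
    pushforward g y v =
      fderiv ℝ (localPosition g p) (extChartAt (𝓡 2) p y) (chartDeriv p y v) := by
  have hmem := (extChartAt (𝓡 2) p).map_source hy
  refine mfderiv_comp_extChartAt hy (((hg.contDiffOn_localPosition p).contDiffAt
    ((isOpen_extChartAt_target p).mem_nhds hmem)).differentiableAt (by simp)) ?_ v
  filter_upwards [(isOpen_extChartAt_source p).mem_nhds hy] with z hz
  simp only [localPosition]
  rw [(extChartAt (𝓡 2) p).left_inv hz]

theorem IsSurface.isSphericalImmersionOn (hg : IsSurface g) (p : L) :
    IsSphericalImmersionOn (localPosition g p) (extChartAt (𝓡 2) p).target where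
  isOpen := isOpen_extChartAt_target p
  contDiffOn := hg.contDiffOn_localPosition p
  inner_self u _ := by
    rw [real_inner_self_eq_norm_sq, localPosition, position, norm_eq_of_mem_sphere]
    norm_num
  linearIndependent u hu := by
    have hy := (extChartAt (𝓡 2) p).map_target hu
    obtain ⟨A, hA⟩ := chartDeriv_isInvertible hy
    rw [LinearIndependent.pair_iff]
    intro s t hst
    let w : Plane := !₂[s, t]
    have h0 : fderiv ℝ (localPosition g p) u w = 0 := by
      rw [fderiv_eq_sum_pd]; simpa [w] using hst
    have h1 := hg.pushforward_eq hy (A.symm w)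
    rw [← hA, (extChartAt (𝓡 2) p).right_inv hu, ContinuousLinearEquiv.coe_coe,
      A.apply_symm_apply, h0] at h1
    have h2 : A.symm w = 0 := hg.pushforward_injective _ (h1.trans
      (map_zero (mfderiv (𝓡 2) 𝓘(ℝ, EuclideanSpace ℝ (Fin (3 + 1))) (position g) _)).symm)
    have h3 : w = 0 := by rw [← A.apply_symm_apply w, h2, map_zero]
    exact ⟨by simpa [w] using congrArg (fun z : Plane => z 0) h3,
      by simpa [w] using congrArg (fun z : Plane => z 1) h3⟩

theorem IsSurface.pushforward_eq_self (hg : IsSurface g) (x : L) (v : TangentSpace (𝓡 2) x) :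
    pushforward g x v =
      fderiv ℝ (localPosition g x) (extChartAt (𝓡 2) x x) (show Plane from v) := by
  rw [hg.pushforward_eq (mem_extChartAt_source x), chartDeriv_self]

theorem IsSurface.pushforward_eq_sum (hg : IsSurface g) (x : L) (v : TangentSpace (𝓡 2) x) :
    pushforward g x v = comp v 0 • pd 0 (localPosition g x) (extChartAt (𝓡 2) x x)
      + comp v 1 • pd 1 (localPosition g x) (extChartAt (𝓡 2) x x) :=
  (hg.pushforward_eq_self x v).trans (fderiv_eq_sum_pd _ _ _)

/-- At a non-umbilic point `normalForm` is not a multiple of the metric. -/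
theorem IsSurface.not_normalForm_eq_smul (hg : IsSurface g) {p : L} (hp : ¬IsUmbilic g p) :
    ¬∃ r : ℝ, ∀ i j, normalForm (localPosition g p) i j (extChartAt (𝓡 2) p p) =
      r * inner ℝ (pd i (localPosition g p) (extChartAt (𝓡 2) p p))
        (pd j (localPosition g p) (extChartAt (𝓡 2) p p)) := by
  rintro ⟨r, hr⟩
  obtain ⟨ζ, hζ⟩ := (hg.isSphericalImmersionOn p).exists_formCoeff_eq_smul
    (mem_extChartAt_target p) hr
  refine hp ⟨ζ, fun v w => ?_⟩
  simp only [secondForm, secondFormCoeff_eq_formCoeff, hζ, inducedMetric,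
    hg.pushforward_eq_sum, Fin.sum_univ_two, gram, Matrix.of_apply, inner_add_left, inner_add_right,
    real_inner_smul_left, real_inner_smul_right]
  module

end Charts

/-! ### Vector fields on the surface -/

section Fields

variable {L : Type*} [TopologicalSpace L] [ChartedSpace (EuclideanSpace ℝ (Fin 2)) L]
  {g : L → UnitSphere 3}

/-- The vector field `Y` in the chart at `x`. -/
def chartField (x : L) (Y : ∀ x : L, TangentSpace (𝓡 2) x) (u : Plane) : Plane :=
  chartDeriv x ((extChartAt (𝓡 2) x).symm u) (Y ((extChartAt (𝓡 2) x).symm u))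

theorem chartField_extChartAt {x z : L} (hz : z ∈ (extChartAt (𝓡 2) x).source)
    (Y : ∀ x : L, TangentSpace (𝓡 2) x) :
    chartField x Y (extChartAt (𝓡 2) x z) = chartDeriv x z (Y z) :=
  congrArg (fun z => chartDeriv x z (Y z)) ((extChartAt (𝓡 2) x).left_inv hz)

variable [IsManifold (𝓡 2) ∞ L]

/-- The vector field on `L` whose components in the chart at `p` are given by `X`. -/
def liftField (p : L) (X : Plane → Plane) (y : L) : TangentSpace (𝓡 2) y :=
  VectorField.mpullback (𝓡 2) 𝓘(ℝ, Plane) (extChartAt (𝓡 2) p) X y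

theorem chartDeriv_liftField {p y : L} (hy : y ∈ (extChartAt (𝓡 2) p).source)
    (X : Plane → Plane) : chartDeriv p y (liftField p X y) = X (extChartAt (𝓡 2) p y) :=
  (chartDeriv_isInvertible hy).self_apply_inverse _

theorem contMDiffAt_liftField {p y : L} (hy : y ∈ (extChartAt (𝓡 2) p).source)
    {X : Plane → Plane} (hX : ContDiffAt ℝ ∞ X (extChartAt (𝓡 2) p y)) :
    ContMDiffAt (𝓡 2) (𝓡 2).tangent ∞
      (fun z => (⟨z, liftField p X z⟩ : TangentBundle (𝓡 2) L)) y := by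
  have : IsManifold (𝓡 2) 1 L := IsManifold.of_le (n := ∞) (by simp)
  have : IsManifold (𝓡 2) (∞ + 1) L := by simpa
  exact ContMDiffAt.mpullback_vectorField_preimage (n := ∞)
    (contMDiffAt_vectorSpace_iff_contDiffAt.2 hX)
    (contMDiffAt_extChartAt' (by simpa using hy)) (chartDeriv_isInvertible hy) (by simp)

theorem differentiableAt_chartField {x : L} {Y : ∀ x : L, TangentSpace (𝓡 2) x}
    (hY : ContMDiffAt (𝓡 2) (𝓡 2).tangent ∞
      (fun z => (⟨z, Y z⟩ : TangentBundle (𝓡 2) L)) x) :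
    DifferentiableAt ℝ (chartField x Y) (extChartAt (𝓡 2) x x) := by
  have : IsManifold (𝓡 2) 1 L := IsManifold.of_le (n := ∞) (by simp)
  have h1 := (Bundle.contMDiffAt_section x).1 hY
  have h2 := (contMDiffAt_iff.1 h1).2
  simp only [ModelWithCorners.range_eq_univ, contDiffWithinAt_univ] at h2
  refine (h2.differentiableAt (by simp)).congr_of_eventuallyEq ?_
  filter_upwards [(isOpen_extChartAt_target x).mem_nhds (mem_extChartAt_target x)] with u hu
  have hz : (extChartAt (𝓡 2) x).symm u ∈ (chartAt (EuclideanSpace ℝ (Fin 2)) x).source := by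
    simpa using (extChartAt (𝓡 2) x).map_target hu
  have h3 := TangentBundle.continuousLinearMapAt_trivializationAt (I := 𝓡 2) hz
  have h4 := congrArg (fun A => A (Y ((extChartAt (𝓡 2) x).symm u))) h3
  refine h4.symm.trans ?_
  simp only [Function.comp_apply, extChartAt_model_space_eq_id, PartialEquiv.refl_coe, id]
  rw [Bundle.Trivialization.continuousLinearMapAt_apply,
    Bundle.Trivialization.linearMapAt_apply, if_pos (by simpa using hz)]

/-- The two conditions `∇_v Y = 0` and `α(v, Y) = 0` hold together if the derivative of `g_* Y`
in the direction `v` is a multiple of the position vector. -/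
theorem IsSurface.covDeriv_eq_zero_and_secondForm_eq_zero (hg : IsSurface g) {x : L}
    {Y : ∀ x : L, TangentSpace (𝓡 2) x}
    (hY : ContMDiffAt (𝓡 2) (𝓡 2).tangent ∞
      (fun z => (⟨z, Y z⟩ : TangentBundle (𝓡 2) L)) x) (v : TangentSpace (𝓡 2) x)
    (h : mfderiv (𝓡 2) 𝓘(ℝ, EuclideanSpace ℝ (Fin 4)) (fun z => pushforward g z (Y z)) x v =
      -inducedMetric g x v (Y x) • position g x) :
    covDeriv g x v Y = 0 ∧ secondForm g x v (Y x) = 0 := by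
  have hf := hg.isSphericalImmersionOn x
  have hu := mem_extChartAt_target (I := 𝓡 2) x
  have hYd := differentiableAt_chartField hY
  have hYx : chartField x Y (extChartAt (𝓡 2) x x) = (show Plane from Y x) :=
    (chartField_extChartAt (mem_extChartAt_source x) Y).trans (chartDeriv_self x _)
  have hfd : DifferentiableAt ℝ (fderiv ℝ (localPosition g x)) (extChartAt (𝓡 2) x x) :=
    ((hf.contDiffOn.fderiv_of_isOpen (m := ∞) hf.isOpen (by simp)).contDiffAt
      (hf.isOpen.mem_nhds hu)).differentiableAt (by simp)
  rw [mfderiv_comp_extChartAt (mem_extChartAt_source x)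
    (h := fun u => fderiv ℝ (localPosition g x) u (chartField x Y u)) (hfd.clm_apply hYd)
    (by
      filter_upwards [(isOpen_extChartAt_source x).mem_nhds
        (mem_extChartAt_source (I := 𝓡 2) x)] with z hz
      rw [chartField_extChartAt hz, hg.pushforward_eq hz]), chartDeriv_self] at h
  have hpos : position g x = localPosition g x (extChartAt (𝓡 2) x x) := by
    rw [localPosition, extChartAt_to_inv]
  rw [inducedMetric, hg.pushforward_eq_self, hg.pushforward_eq_self, hpos, ← hYx] at h
  obtain ⟨h1, h2⟩ := hf.eq_zero_of_fderiv_fderiv_apply hu hYd _ h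
  rw [hYx] at h1 h2
  refine ⟨h1, ?_⟩
  simp only [secondForm, secondFormCoeff_eq_formCoeff]
  exact h2

end Fields

end SphereSurface

end

theorem mainTheorem5 {L : Type*} [TopologicalSpace L]
    [ChartedSpace (EuclideanSpace ℝ (Fin 2)) L] [IsManifold (𝓡 2) ∞ L]
    (g : L → SphereSurface.UnitSphere 3) (hg : SphereSurface.IsSurface g)
    (hK : ∀ x : L, SphereSurface.gaussCurvature g x ≠ 1) :
    ∀ p : L, ¬ SphereSurface.IsUmbilic g p →
      ∃ U : Set L, IsOpen U ∧ p ∈ U ∧ SphereSurface.IsTypeDOn g U := by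
  open SphereSurface Set Filter Topology in
  intro p hp
  have hf := hg.isSphericalImmersionOn p
  obtain ⟨W, X, Y, hW, hpW, hWV, hX, hY, hXY⟩ := exists_conjugate_fields hf
    (mem_extChartAt_target p) (hg.not_normalForm_eq_smul hp)
  set φ := extChartAt (𝓡 2) p with hφ
  have hU : IsOpen (φ.source ∩ φ ⁻¹' W) := isOpen_extChartAt_preimage' p hW
  have hsmooth : ∀ Z : Plane → Plane, ContDiffOn ℝ ∞ Z W → ∀ y ∈ φ.source ∩ φ ⁻¹' W,
      ContMDiffAt (𝓡 2) (𝓡 2).tangent ∞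
        (fun z => (⟨z, liftField p Z z⟩ : TangentBundle (𝓡 2) L)) y := fun Z hZ y hy =>
    contMDiffAt_liftField hy.1 (hZ.contDiffAt (hW.mem_nhds hy.2))
  have hpush : ∀ Z : Plane → Plane, ∀ y ∈ φ.source, pushforward g y (liftField p Z y) =
      fderiv ℝ (localPosition g p) (φ y) (Z (φ y)) := fun Z y hy => by
    rw [hg.pushforward_eq hy, chartDeriv_liftField hy]
  refine ⟨φ.source ∩ φ ⁻¹' W, hU, ⟨mem_extChartAt_source p, hpW⟩, liftField p X, liftField p Y,
    fun y hy => (hsmooth X hX y hy).contMDiffWithinAt,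
    fun y hy => (hsmooth Y hY y hy).contMDiffWithinAt, fun y hy => ?_⟩
  obtain ⟨hind, hunit, hne, hder⟩ := hXY (φ y) hy.2
  have hmetric : ∀ Z Z' : Plane → Plane, inducedMetric g y (liftField p Z y) (liftField p Z' y) =
      inner ℝ (fderiv ℝ (localPosition g p) (φ y) (Z (φ y)))
        (fderiv ℝ (localPosition g p) (φ y) (Z' (φ y))) := fun Z Z' => by
    rw [inducedMetric, hpush Z y hy.1, hpush Z' y hy.1]
  refine ⟨?_, (hmetric Y Y).trans hunit, ?_, ?_⟩
  · refine LinearIndependent.of_comp (chartDeriv p y).toLinearMap ?_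
    convert! hind using 1
    ext i : 1
    fin_cases i
    · exact chartDeriv_liftField hy.1 X
    · exact chartDeriv_liftField hy.1 Y
  · rw [hmetric]; exact hne
  · refine hg.covDeriv_eq_zero_and_secondForm_eq_zero (hsmooth Y hY y hy) _ ?_
    have hfd : DifferentiableAt ℝ (fderiv ℝ (localPosition g p)) (φ y) :=
      ((hf.contDiffOn.fderiv_of_isOpen (m := ∞) hf.isOpen (by simp)).contDiffAt
        (hf.isOpen.mem_nhds (hWV hy.2))).differentiableAt (by simp)
    have hYd : DifferentiableAt ℝ Y (φ y) :=
      (hY.contDiffAt (hW.mem_nhds hy.2)).differentiableAt (by simp)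
    rw [mfderiv_comp_extChartAt hy.1
      (h := fun u => fderiv ℝ (localPosition g p) u (Y u)) (hfd.clm_apply hYd)
      (by
        filter_upwards [(isOpen_extChartAt_source p).mem_nhds hy.1] with z hz
        exact hpush Y z hz), chartDeriv_liftField hy.1, hmetric]
    refine hder.trans ?_
    rw [localPosition, φ.left_inv hy.1]
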